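/- Write $\mathrm{AGL}_4(\mathbb R)$ for the group of invertible $5\times5$ real matrices with first column $(1,0,0,0,0)^{T}$; it acts on the right on the row vectors $(1,v)$, $v\in\mathbb R^4$. A subgroup $R$ is regular if for every $v\in\mathbb R^4$ it has exactly one element with first row $(1,v)$. There are exactly $12$ conjugacy classes of abelian regular subgroups of $\mathrm{AGL}_4(\mathbb R)$. They are represented by the following $12$ abelian regular subgroups: every abelian regular subgroup of $\mathrm{AGL}_4(\mathbb R)$ is conjugate in $\mathrm{AGL}_4(\mathbb R)$ to exactly one of $$S_{(5)},\ S_{(4,1)},\ S_{(3,2)}^\sharp,\ U_1(0,0),\ U_1(0,1),\ U_1(0,-1),$$ $$R_{E_{1,1}},\ R_{E_{1,1}+E_{2,2}},\ R_{E_{1,1}-E_{2,2}},\ R_{E_{1,1}+E_{2,2}-E_{3,3}},\ R_{I_3},\ \mathrm{Tr}_4 .$$ Here $E_{i,j}$ is the $3\times 3$ elementary matrix, $\mathrm{Tr}_4=R_0$ is the translation group, and, with $x_1,\dots,x_4$ running over $\mathbb R$ and $X=(x_1,x_2,x_3)$, $$S_{(5)}=\begin{pmatrix}1&x_1&x_2&x_3&x_4\\0&1&x_1&x_2&x_3\\0&0&1&x_1&x_2\\0&0&0&1&x_1\\0&0&0&0&1\end{pmatrix},\quad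 S_{(4,1)}=\begin{pmatrix}1&x_1&x_2&x_3&x_4\\0&1&x_1&x_2&0\\0&0&1&x_1&0\\0&0&0&1&0\\0&0&0&0&1\end{pmatrix},\quad S_{(3,2)}^\sharp=\begin{pmatrix}1&x_1&x_2&x_3&x_4\\0&1&x_1&0&x_2\\0&0&1&0&x_1\\0&0&0&1&x_3\\0&0&0&0&1\end{pmatrix},$$ $$U_1(\alpha,\beta)=\begin{pmatrix}1&x_1&x_2&x_3&x_4\\0&1&0&x_1&x_2\\0&0&1&\beta x_2&x_1+\alpha x_2\\0&0&0&1&0\\0&0&0&0&1\end{pmatrix},\quad R_D=\begin{pmatrix}1&X&x_4\\0&I_3&DX^{T}\\0&0&1\end{pmatrix}.$$ Equivalently, there are exactly $12$ isomorphism classes of $4$-dimensional commutative nilpotent associative real algebras. More precisely, for every abelian regular subgroup $R$ of $\mathrm{AGL}_4(\mathbb R)$ the set $R-I_5=\{r-I_5:r\in R\}$ is a $4$-dimensional commutative nilpotent subalgebra of $\mathrm{Mat}_5(\mathbb R)$; two abelian regular subgroups $R,S$ are conjugate in $\mathrm{AGL}_4(\mathbb R)$ if and only if the algebras $R-I_5$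 and $S-I_5$ are isomorphic; and every $4$-dimensional commutative nilpotent associative real algebra is isomorphic to $R-I_5$ for exactly one $R$ in the list above. -/

import Mathlib

open Matrix

universe u

theorem mulVec_single_zero_iff {n : ℕ} {F : Type*} [Field F]
    (m : Matrix (Fin (n + 1)) (Fin (n + 1)) F) :
    m *ᵥ Pi.single 0 1 = Pi.single 0 1 ↔ ∀ i, m i 0 = if i = 0 then 1 else 0 := by
  rw [Matrix.mulVec_single_one, funext_iff]
  simp [Matrix.col, Pi.single_apply]

/-- The affine group `AGL_n(F)`: the subgroup of `GL_{n+1}(F)` of the invertible matrices whose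
first column is `(1, 0, …, 0)ᵀ`. It acts on the right on the row vectors `(1, v)`. -/
def AGL (n : ℕ) (F : Type*) [Field F] : Subgroup (GL (Fin (n + 1)) F) where
  carrier := {g | ∀ i, (g : Matrix (Fin (n + 1)) (Fin (n + 1)) F) i 0 = if i = 0 then 1 else 0}
  one_mem' := fun i => by simp [Matrix.one_apply]
  mul_mem' := fun {a b} ha hb => (mulVec_single_zero_iff _).1 <| by
    rw [Units.val_mul, ← Matrix.mulVec_mulVec, (mulVec_single_zero_iff _).2 hb,
      (mulVec_single_zero_iff _).2 ha]
  inv_mem' := fun {a} ha => (mulVec_single_zero_iff _).1 <| by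
    conv_lhs => rw [← (mulVec_single_zero_iff _).2 ha, Matrix.mulVec_mulVec, ← Units.val_mul,
      inv_mul_cancel, Units.val_one, Matrix.one_mulVec]

namespace AGL

variable {n : ℕ} {F : Type*} [Field F]

/-- The underlying matrix of an affine transformation. -/
def mat (g : AGL n F) : Matrix (Fin (n + 1)) (Fin (n + 1)) F :=
  ((g : GL (Fin (n + 1)) F) : Matrix (Fin (n + 1)) (Fin (n + 1)) F)

theorem mat_injective : Function.Injective (mat : AGL n F → _) := fun _ _ h =>
  Subtype.ext (Units.ext h)

/-- `R` is regular: for every `v` it has exactly one element with first row `(1, v)`, i.e. exactly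
one element that maps `(1, 0)` to `(1, v)`. -/
def IsRegular (R : Subgroup (AGL n F)) : Prop :=
  ∀ v : Fin n → F, ∃! r : AGL n F, r ∈ R ∧ mat r 0 = Matrix.vecCons 1 v

/-- `R` is abelian. -/
def IsAbelian (R : Subgroup (AGL n F)) : Prop :=
  ∀ r ∈ R, ∀ s ∈ R, r * s = s * r

/-- `R` and `S` are conjugate in `AGL_n(F)`: `g R g⁻¹ = S` for some `g`. -/
def AreConj (R S : Subgroup (AGL n F)) : Prop :=
  ∃ g : AGL n F, R.map (MulAut.conj g).toMonoidHom = S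

theorem areConj_equivalence : Equivalence (AreConj : Subgroup (AGL n F) → _ → Prop) where
  refl R := ⟨1, by ext x; simp⟩
  symm := by
    rintro R _ ⟨g, rfl⟩
    refine ⟨g⁻¹, ?_⟩
    ext x
    simp [Subgroup.map_map, Subgroup.mem_map, mul_assoc]
  trans := by
    rintro R _ _ ⟨g, rfl⟩ ⟨h, rfl⟩
    refine ⟨h * g, ?_⟩
    ext x
    simp [Subgroup.map_map, Subgroup.mem_map, mul_assoc]

variable (n F)

/-- The abelian regular subgroups of `AGL_n(F)`. -/
abbrev AbelianRegular : Type _ := {R : Subgroup (AGL n F) // IsRegular R ∧ IsAbelian R}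

/-- Conjugacy in `AGL_n(F)`, on the abelian regular subgroups. -/
def conjSetoid : Setoid (AbelianRegular n F) :=
  Setoid.comap Subtype.val ⟨AreConj, areConj_equivalence⟩

/-- The set of conjugacy classes of abelian regular subgroups of `AGL_n(F)`. -/
abbrev AbelianRegularClasses : Type _ := Quotient (conjSetoid n F)

variable {n F}

/-- The subset `R - I_{n+1}` of `Mat_{n+1}(F)`. -/
def subOne (R : Subgroup (AGL n F)) : Set (Matrix (Fin (n + 1)) (Fin (n + 1)) F) :=
  {m | ∃ r ∈ R, m = mat r - 1}

/-- The (non-unital) subalgebra of `Mat_{n+1}(F)` generated by `R - I_{n+1}`. -/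
def nilAlgebra (R : Subgroup (AGL n F)) :
    NonUnitalSubalgebra F (Matrix (Fin (n + 1)) (Fin (n + 1)) F) :=
  NonUnitalAlgebra.adjoin F (subOne R)

/-- The subgroup of the affine transformations whose matrix has the form `M x` for some `x`. -/
def ofForm (M : (Fin n → F) → Matrix (Fin (n + 1)) (Fin (n + 1)) F)
    (hone : ∃ x, M x = 1) (hmul : ∀ x y, ∃ z, M x * M y = M z) (hinv : ∀ x, ∃ y, M x * M y = 1) :
    Subgroup (AGL n F) where
  carrier := {g | ∃ x, mat g = M x}
  one_mem' := by
    obtain ⟨x, hx⟩ := hone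
    exact ⟨x, hx.symm⟩
  mul_mem' := by
    rintro a b ⟨x, hx⟩ ⟨y, hy⟩
    obtain ⟨z, hz⟩ := hmul x y
    refine ⟨z, ?_⟩
    rw [← hz, ← hx, ← hy]
    rfl
  inv_mem' := by
    rintro a ⟨x, hx⟩
    obtain ⟨y, hy⟩ := hinv x
    refine ⟨y, ?_⟩
    have h1 : mat a⁻¹ * mat a = 1 := by
      change mat (a⁻¹ * a) = 1
      rw [inv_mul_cancel]
      rfl
    rw [← Matrix.mul_one (mat a⁻¹), ← hy, ← hx, ← Matrix.mul_assoc, h1, Matrix.one_mul]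

section Forms

variable (F)

/-- The matrices of `S_(5)`. -/
def formS5 (x : Fin 4 → F) : Matrix (Fin 5) (Fin 5) F :=
  !![1, x 0, x 1, x 2, x 3;
     0, 1, x 0, x 1, x 2;
     0, 0, 1, x 0, x 1;
     0, 0, 0, 1, x 0;
     0, 0, 0, 0, 1]

/-- The matrices of `S_(4,1)`. -/
def formS41 (x : Fin 4 → F) : Matrix (Fin 5) (Fin 5) F :=
  !![1, x 0, x 1, x 2, x 3;
     0, 1, x 0, x 1, 0;
     0, 0, 1, x 0, 0;
     0, 0, 0, 1, 0;
     0, 0, 0, 0, 1]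

/-- The matrices of `S_(3,2)^♯`. -/
def formS32 (x : Fin 4 → F) : Matrix (Fin 5) (Fin 5) F :=
  !![1, x 0, x 1, x 2, x 3;
     0, 1, x 0, 0, x 1;
     0, 0, 1, 0, x 0;
     0, 0, 0, 1, x 2;
     0, 0, 0, 0, 1]

variable {F}

/-- The matrices of `U_1(α, β)`. -/
def formU1 (α β : F) (x : Fin 4 → F) : Matrix (Fin 5) (Fin 5) F :=
  !![1, x 0, x 1, x 2, x 3;
     0, 1, 0, x 0, x 1;
     0, 0, 1, β * x 1, x 0 + α * x 1;
     0, 0, 0, 1, 0;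
     0, 0, 0, 0, 1]

/-- The matrices of `R_D`: rows `(1, X, x₄)`, `(0, I₃, D Xᵀ)`, `(0, 0, 1)` in block form, with
`X = (x₁, x₂, x₃)`. -/
def formR (D : Matrix (Fin 3) (Fin 3) F) (x : Fin 4 → F) : Matrix (Fin 5) (Fin 5) F :=
  !![1, x 0, x 1, x 2, x 3;
     0, 1, 0, 0, D 0 0 * x 0 + D 0 1 * x 1 + D 0 2 * x 2;
     0, 0, 1, 0, D 1 0 * x 0 + D 1 1 * x 1 + D 1 2 * x 2;
     0, 0, 0, 1, D 2 0 * x 0 + D 2 1 * x 1 + D 2 2 * x 2;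
     0, 0, 0, 0, 1]

variable (F)

/-- The matrices of the translation group of `F⁴`. -/
def formTr (x : Fin 4 → F) : Matrix (Fin 5) (Fin 5) F :=
  !![1, x 0, x 1, x 2, x 3;
     0, 1, 0, 0, 0;
     0, 0, 1, 0, 0;
     0, 0, 0, 1, 0;
     0, 0, 0, 0, 1]

/-- The subgroup `S_(5)` of `AGL_4(F)`. -/
def S5 : Subgroup (AGL 4 F) :=
  ofForm (formS5 F)
    ⟨0, by simp [formS5, ← Matrix.ext_iff, Fin.forall_fin_succ]⟩
    (fun x y => ⟨![x 0 + y 0, x 1 + x 0 * y 0 + y 1, x 2 + x 1 * y 0 + x 0 * y 1 + y 2,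
        x 3 + x 2 * y 0 + x 1 * y 1 + x 0 * y 2 + y 3], by
      simp [formS5, ← Matrix.ext_iff, Fin.forall_fin_succ] <;> (try constructorm* _ ∧ _) <;> ring⟩)
    (fun x => ⟨![-x 0, x 0 ^ 2 - x 1, -x 2 + 2 * x 0 * x 1 - x 0 ^ 3,
        -x 3 + 2 * x 0 * x 2 + x 1 ^ 2 - 3 * x 0 ^ 2 * x 1 + x 0 ^ 4], by
      simp [formS5, ← Matrix.ext_iff, Fin.forall_fin_succ] <;> (try constructorm* _ ∧ _) <;> ring⟩)

/-- The subgroup `S_(4,1)` of `AGL_4(F)`. -/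
def S41 : Subgroup (AGL 4 F) :=
  ofForm (formS41 F)
    ⟨0, by simp [formS41, ← Matrix.ext_iff, Fin.forall_fin_succ]⟩
    (fun x y => ⟨![x 0 + y 0, x 1 + x 0 * y 0 + y 1, x 2 + x 1 * y 0 + x 0 * y 1 + y 2,
        x 3 + y 3], by
      simp [formS41, ← Matrix.ext_iff, Fin.forall_fin_succ] <;> (try constructorm* _ ∧ _) <;> ring⟩)
    (fun x => ⟨![-x 0, x 0 ^ 2 - x 1, -x 2 + 2 * x 0 * x 1 - x 0 ^ 3, -x 3], by
      simp [formS41, ← Matrix.ext_iff, Fin.forall_fin_succ] <;> (try constructorm* _ ∧ _) <;> ring⟩)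

/-- The subgroup `S_(3,2)^♯` of `AGL_4(F)`. -/
def S32 : Subgroup (AGL 4 F) :=
  ofForm (formS32 F)
    ⟨0, by simp [formS32, ← Matrix.ext_iff, Fin.forall_fin_succ]⟩
    (fun x y => ⟨![x 0 + y 0, x 1 + x 0 * y 0 + y 1, x 2 + y 2,
        x 3 + x 0 * y 1 + x 1 * y 0 + x 2 * y 2 + y 3], by
      simp [formS32, ← Matrix.ext_iff, Fin.forall_fin_succ] <;> (try constructorm* _ ∧ _) <;> ring⟩)
    (fun x => ⟨![-x 0, x 0 ^ 2 - x 1, -x 2,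
        -x 3 + 2 * x 0 * x 1 - x 0 ^ 3 + x 2 ^ 2], by
      simp [formS32, ← Matrix.ext_iff, Fin.forall_fin_succ] <;> (try constructorm* _ ∧ _) <;> ring⟩)

/-- The translation subgroup `Tr_4` of `AGL_4(F)`. -/
def Tr4 : Subgroup (AGL 4 F) :=
  ofForm (formTr F)
    ⟨0, by simp [formTr, ← Matrix.ext_iff, Fin.forall_fin_succ]⟩
    (fun x y => ⟨x + y, by
      simp [formTr, ← Matrix.ext_iff, Fin.forall_fin_succ] <;> (try constructorm* _ ∧ _) <;> ring⟩)
    (fun x => ⟨-x, by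
      simp [formTr, ← Matrix.ext_iff, Fin.forall_fin_succ]⟩)

variable {F}

/-- The subgroup `U_1(α, β)` of `AGL_4(F)`. -/
def U1 (α β : F) : Subgroup (AGL 4 F) :=
  ofForm (formU1 α β)
    ⟨0, by simp [formU1, ← Matrix.ext_iff, Fin.forall_fin_succ]⟩
    (fun x y => ⟨![x 0 + y 0, x 1 + y 1, x 2 + x 0 * y 0 + β * x 1 * y 1 + y 2,
        x 3 + x 0 * y 1 + x 1 * (y 0 + α * y 1) + y 3], by
      simp [formU1, ← Matrix.ext_iff, Fin.forall_fin_succ] <;> (try constructorm* _ ∧ _) <;> ring⟩)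
    (fun x => ⟨![-x 0, -x 1, -x 2 + x 0 ^ 2 + β * x 1 ^ 2,
        -x 3 + 2 * x 0 * x 1 + α * x 1 ^ 2], by
      simp [formU1, ← Matrix.ext_iff, Fin.forall_fin_succ] <;> (try constructorm* _ ∧ _) <;> ring⟩)

/-- The subgroup `R_D` of `AGL_4(F)`. -/
def RD (D : Matrix (Fin 3) (Fin 3) F) : Subgroup (AGL 4 F) :=
  ofForm (formR D)
    ⟨0, by
      simp [formR, ← Matrix.ext_iff, Fin.forall_fin_succ]⟩
    (fun x y => ⟨![x 0 + y 0, x 1 + y 1, x 2 + y 2,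
        x 3 + x 0 * (D 0 0 * y 0 + D 0 1 * y 1 + D 0 2 * y 2)
          + x 1 * (D 1 0 * y 0 + D 1 1 * y 1 + D 1 2 * y 2)
          + x 2 * (D 2 0 * y 0 + D 2 1 * y 1 + D 2 2 * y 2) + y 3], by
      simp [formR, ← Matrix.ext_iff, Fin.forall_fin_succ] <;> (try constructorm* _ ∧ _) <;> ring⟩)
    (fun x => ⟨![-x 0, -x 1, -x 2,
        -x 3 + x 0 * (D 0 0 * x 0 + D 0 1 * x 1 + D 0 2 * x 2)
          + x 1 * (D 1 0 * x 0 + D 1 1 * x 1 + D 1 2 * x 2)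
          + x 2 * (D 2 0 * x 0 + D 2 1 * x 1 + D 2 2 * x 2)], by
      simp [formR, ← Matrix.ext_iff, Fin.forall_fin_succ] <;> (try constructorm* _ ∧ _) <;> ring⟩)

/-- The elementary matrix `E_{i,j}` of `Mat_3(ℝ)`, with indices counted from `0`. -/
abbrev E (i j : Fin 3) : Matrix (Fin 3) (Fin 3) ℝ := Matrix.single i j 1

/-- The twelve representatives over `ℝ`. -/
noncomputable def realRep : Fin 12 → Subgroup (AGL 4 ℝ) :=
  ![S5 ℝ, S41 ℝ, S32 ℝ, U1 0 0, U1 0 1, U1 0 (-1),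
    RD (E 0 0), RD (E 0 0 + E 1 1), RD (E 0 0 - E 1 1), RD (E 0 0 + E 1 1 - E 2 2), RD 1, Tr4 ℝ]

end Forms

end AGL

/-- A (not necessarily unital) ring `A` is nilpotent: for some `k`, all products of `k + 1`
elements of `A` are zero. -/
def IsNilpotentAlgebra (A : Type*) [NonUnitalRing A] : Prop :=
  ∃ k : ℕ, ∀ (a : A) (l : List A), l.length = k → l.foldl (· * ·) a = 0

/-- A commutative nilpotent associative algebra of dimension `n` over `F`. -/
structure CommNilpotentAlgebra (F : Type*) [Field F] (n : ℕ) where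
  carrier : Type u
  [commRing : NonUnitalCommRing carrier]
  [module : Module F carrier]
  [isScalarTower : IsScalarTower F carrier carrier]
  [smulCommClass : SMulCommClass F carrier carrier]
  finite : Module.Finite F carrier
  finrank_eq : Module.finrank F carrier = n
  nilpotent : IsNilpotentAlgebra carrier

attribute [instance] CommNilpotentAlgebra.commRing CommNilpotentAlgebra.module
  CommNilpotentAlgebra.isScalarTower CommNilpotentAlgebra.smulCommClass

/-- `A` and `B` are isomorphic as (not necessarily unital) `F`-algebras. -/
def AlgIsomorphic (F : Type*) [Field F] (A B : Type*) [NonUnitalRing A] [NonUnitalRing B]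
    [Module F A] [Module F B] : Prop :=
  ∃ e : A ≃ₗ[F] B, ∀ x y : A, e (x * y) = e x * e y

namespace CommNilpotentAlgebra

/-- Isomorphism of commutative nilpotent algebras of dimension `n`. -/
def isoSetoid (F : Type*) [Field F] (n : ℕ) : Setoid (CommNilpotentAlgebra.{u} F n) where
  r A B := AlgIsomorphic F A.carrier B.carrier
  iseqv :=
    { refl := fun A => ⟨LinearEquiv.refl F A.carrier, fun _ _ => rfl⟩
      symm := by
        rintro A B ⟨e, he⟩
        refine ⟨e.symm, fun x y => e.injective ?_⟩
        simp [he]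
      trans := by
        rintro A B C ⟨e, he⟩ ⟨f, hf⟩
        exact ⟨e.trans f, fun x y => by simp [he, hf]⟩ }

/-- The isomorphism classes of commutative nilpotent `F`-algebras of dimension `n`. -/
abbrev IsoClasses (F : Type*) [Field F] (n : ℕ) : Type _ := Quotient (isoSetoid.{u} F n)

end CommNilpotentAlgebra

/-! For an abelian regular subgroup $R$, a matrix commuting with $R$ is determined by its first row,
since $R$ moves $(1,0)$ to every $(1,v)$. Hence $R-I$ is the part of the centralizer of $R$ with
vanishing first entry, so it is an algebra, and reading off first rows identifies it with $F^n$.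
Inverses in $R$ give quasi-inverses in $R-I$, which forces nilpotency. An algebra isomorphism
$R-I\to S-I$, read on first rows and extended by fixing $e_0$, is an affine matrix conjugating $R$
to $S$; so conjugacy of subgroups is isomorphism of algebras (`areConj_iff_algIsomorphic`).

It remains to classify the real commutative nilpotent algebras $A$ of dimension 4
(`exists_prodIso_realProd`). If $x^4\ne0$ for some $x$, the powers of $x$ form a basis. If fourth
powers vanish but $x^3\ne0$, the powers of $x$ are completed by some $z$ with $xz=0$ and
$z^2\in\mathbb R x^3$. If all cubes vanish, polarization gives $A\cdot A^2=0$, and the product is a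
symmetric bilinear map on a complement $W$ of the span $A^2$. Then $\dim A^2\le2$: dimension 0 is
the zero product, dimension 1 is a quadratic form on $\mathbb R^3$ up to sign (Sylvester), and
dimension 2 reduces to $v^2=\beta u^2$ with $\beta\in\{0,1,-1\}$.

The twelve models are pairwise non-isomorphic because `prodIndex`, a decision tree of isomorphism
invariants, takes the value $i$ on the $i$-th one. -/

/-! ### Nilpotency from quasi-invertibility -/

/-- A finite-dimensional commutative algebra whose elements are all quasi-invertible is nilpotent. -/
theorem isNilpotentAlgebra_of_quasiregular (F : Type*) {A : Type*} [Field F] [NonUnitalRing A]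
    [Module F A] [IsScalarTower F A A] [SMulCommClass F A A] [Module.Finite F A]
    (hcomm : ∀ a b : A, a * b = b * a) (h : ∀ a : A, ∃ b, a + b + a * b = 0) :
    IsNilpotentAlgebra A := by
  let _ : NonUnitalCommRing A := { (inferInstance : NonUnitalRing A) with mul_comm := hcomm }
  have : Module.Finite F (Unitization F A) :=
    Module.Finite.equiv (Unitization.linearEquiv F F A).symm
  have : IsArtinianRing (Unitization F A) := IsArtinianRing.of_finite F _
  obtain ⟨k, hk⟩ := IsArtinianRing.isNilpotent_jacobson_bot (R := Unitization F A)
  -- A product $ay$ lies in $A$ again, and $1+b$ inverts $1+ay$ when $b$ is the quasi-inverse of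
  -- $ay$.
  have hmem : ∀ a : A, (a : Unitization F A) ∈ Ideal.jacobson (⊥ : Ideal (Unitization F A)) := by
    intro a
    rw [Ideal.mem_jacobson_bot]
    intro y
    have hy : (a : Unitization F A) * y = ((a * y.snd + y.fst • a : A) : Unitization F A) := by
      ext <;> simp [add_comm]
    obtain ⟨b, hb⟩ := h (a * y.snd + y.fst • a)
    rw [hy]
    refine IsUnit.of_mul_eq_one (1 + (b : Unitization F A)) ?_
    rw [add_mul, mul_add, one_mul, mul_one, ← Unitization.inr_mul]
    have := congrArg (Unitization.inr (R := F)) hb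
    rw [Unitization.inr_add, Unitization.inr_add, Unitization.inr_zero] at this
    linear_combination this
  have key : ∀ (l : List A) (m : ℕ) (a : A),
      (a : Unitization F A) ∈ Ideal.jacobson (⊥ : Ideal (Unitization F A)) ^ m →
      ((l.foldl (· * ·) a : A) : Unitization F A) ∈
        Ideal.jacobson (⊥ : Ideal (Unitization F A)) ^ (m + l.length) := by
    intro l
    induction l with
    | nil => intro m a ha; simpa using ha
    | cons c l ih =>
      intro m a ha
      have := ih (m + 1) (a * c) (by
        rw [Unitization.inr_mul, pow_succ]
        exact Ideal.mul_mem_mul ha (hmem c))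
      rw [List.foldl_cons, List.length_cons]
      convert this using 2
      ring
  refine ⟨k, fun a l hl => Unitization.inr_injective (R := F) ?_⟩
  -- Exponent 0 for the initial factor suffices: the $k$ elements of the list already reach the
  -- vanishing $k$-th power of the radical.
  have := key l 0 a (by simp)
  rw [hl, zero_add, hk] at this
  simpa using this

/-! ### Abelian regular subgroups and their algebras -/

namespace AGL

variable {n : ℕ} {F : Type*} [Field F] {R S : Subgroup (AGL n F)}

theorem mat_mul (g h : AGL n F) : mat (g * h) = mat g * mat h := rfl

theorem mat_one : mat (1 : AGL n F) = 1 := rfl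

theorem mat_mul_mat_inv (g : AGL n F) : mat g * mat g⁻¹ = 1 := by
  rw [← mat_mul, mul_inv_cancel, mat_one]

theorem mat_inv_mul_mat (g : AGL n F) : mat g⁻¹ * mat g = 1 := by
  rw [← mat_mul, inv_mul_cancel, mat_one]

theorem mat_col_zero (g : AGL n F) (i : Fin (n + 1)) : mat g i 0 = if i = 0 then 1 else 0 :=
  g.2 i

theorem row_zero_mul (m k : Matrix (Fin (n + 1)) (Fin (n + 1)) F) : (m * k) 0 = m 0 ᵥ* k := by
  ext j
  simp [Matrix.mul_apply, Matrix.vecMul, dotProduct]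

/-- A matrix that commutes with a regular subgroup is determined by its first row. -/
theorem IsRegular.eq_zero_of_commute (hR : IsRegular R)
    {m : Matrix (Fin (n + 1)) (Fin (n + 1)) F} (hm : ∀ r ∈ R, m * mat r = mat r * m)
    (h0 : m 0 = 0) : m = 0 := by
  -- With $r\in R$ of first row $(1,v)$, the vector $(1,v)m$ is the first row of $rm=mr$, which is
  -- the zero row times $r$.
  have key : ∀ v : Fin n → F, vecCons 1 v ᵥ* m = 0 := by
    intro v
    obtain ⟨r, ⟨hr, hv⟩, -⟩ := hR v
    rw [← hv, ← row_zero_mul, ← hm r hr, row_zero_mul, h0, zero_vecMul]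
  ext i j
  refine Fin.cases ?_ (fun i => ?_) i
  · rw [h0]; rfl
  · have := congrFun (key (Pi.single i 1)) j
    simpa [Matrix.vecMul, dotProduct, Fin.sum_univ_succ, h0, Pi.single_apply] using this

theorem col_zero_of_mem_subOne {m : Matrix (Fin (n + 1)) (Fin (n + 1)) F} (hm : m ∈ subOne R)
    (i : Fin (n + 1)) : m i 0 = 0 := by
  obtain ⟨r, -, rfl⟩ := hm
  rw [Matrix.sub_apply, mat_col_zero, Matrix.one_apply, sub_self]

/-- `R - I` consists of the matrices in the centralizer of `R` whose first entry vanishes. -/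
theorem mem_subOne_iff (hR : IsRegular R) (hA : IsAbelian R)
    {m : Matrix (Fin (n + 1)) (Fin (n + 1)) F} :
    m ∈ subOne R ↔ (∀ r ∈ R, m * mat r = mat r * m) ∧ m 0 0 = 0 := by
  constructor
  · intro hm
    refine ⟨fun r hr => ?_, col_zero_of_mem_subOne hm 0⟩
    obtain ⟨s, hs, rfl⟩ := hm
    rw [sub_mul, mul_sub, ← mat_mul, ← mat_mul, hA s hs r hr, one_mul, mul_one]
  · rintro ⟨hm, h0⟩
    -- For this $r$, the matrix $m-(r-1)$ commutes with $R$ and has zero first row.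
    obtain ⟨r, ⟨hr, hv⟩, -⟩ := hR (fun j => m 0 j.succ)
    refine ⟨r, hr, ?_⟩
    rw [← sub_eq_zero]
    refine hR.eq_zero_of_commute (fun s hs => ?_) ?_
    · rw [sub_mul, mul_sub, hm s hs, sub_mul, mul_sub, ← mat_mul, ← mat_mul, hA r hr s hs,
        one_mul, mul_one]
    · ext j
      refine Fin.cases ?_ (fun j => ?_) j
      · simp [hv, h0]
      · simp [hv, (Fin.succ_ne_zero j).symm]

/-- The centralizer description `mem_subOne_iff` is stable under the algebra operations, so
adjoining adds nothing. For the corner entry of a product, the whole first column of the right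
factor vanishes. -/
theorem coe_nilAlgebra (hR : IsRegular R) (hA : IsAbelian R) :
    (nilAlgebra R : Set (Matrix (Fin (n + 1)) (Fin (n + 1)) F)) = subOne R := by
  refine Set.Subset.antisymm ?_ (NonUnitalAlgebra.subset_adjoin F)
  have hiff := @mem_subOne_iff n F _ R hR hA
  let T : NonUnitalSubalgebra F (Matrix (Fin (n + 1)) (Fin (n + 1)) F) :=
    { carrier := subOne R
      add_mem' := by
        intro a b ha hb
        rw [hiff] at *
        exact ⟨fun r hr => by rw [add_mul, mul_add, ha.1 r hr, hb.1 r hr], by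
          rw [Matrix.add_apply, ha.2, hb.2, add_zero]⟩
      zero_mem' := hiff.2 ⟨fun r hr => by rw [zero_mul, mul_zero], rfl⟩
      mul_mem' := by
        intro a b ha hb
        have hb0 := col_zero_of_mem_subOne hb
        rw [hiff] at *
        refine ⟨fun r hr => ?_, ?_⟩
        · rw [mul_assoc, hb.1 r hr, ← mul_assoc, ha.1 r hr, mul_assoc]
        · simp [Matrix.mul_apply, hb0]
      smul_mem' := by
        intro c a ha
        rw [hiff] at *
        refine ⟨fun r hr => ?_, ?_⟩
        · rw [smul_mul_assoc, mul_smul_comm, ha.1 r hr]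
        · rw [Matrix.smul_apply, ha.2, smul_zero] }
  exact NonUnitalAlgebra.adjoin_le (S := T) subset_rfl

theorem mem_nilAlgebra (hR : IsRegular R) (hA : IsAbelian R)
    {m : Matrix (Fin (n + 1)) (Fin (n + 1)) F} : m ∈ nilAlgebra R ↔ m ∈ subOne R := by
  rw [← coe_nilAlgebra hR hA, SetLike.mem_coe]

theorem nilAlgebra_mul_comm (hR : IsRegular R) (hA : IsAbelian R) (x y : nilAlgebra R) :
    x * y = y * x := by
  obtain ⟨x, hx⟩ := x
  obtain ⟨y, hy⟩ := y
  rw [mem_nilAlgebra hR hA] at hx hy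
  obtain ⟨r, hr, rfl⟩ := hx
  obtain ⟨s, hs, rfl⟩ := hy
  refine Subtype.ext ?_
  change (mat r - 1) * (mat s - 1) = (mat s - 1) * (mat r - 1)
  have : mat r * mat s = mat s * mat r := by rw [← mat_mul, hA r hr s hs, mat_mul]
  rw [sub_mul, mul_sub, sub_mul, mul_sub, this]
  noncomm_ring

theorem nilAlgebra_col_zero (hR : IsRegular R) (hA : IsAbelian R) (a : nilAlgebra R)
    (i : Fin (n + 1)) : a.1 i 0 = 0 :=
  col_zero_of_mem_subOne ((mem_nilAlgebra hR hA).1 a.2) i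

/-- An element of `R - I` is determined by its first row, which is arbitrary. -/
noncomputable def rowEquiv (hR : IsRegular R) (hA : IsAbelian R) :
    nilAlgebra R ≃ₗ[F] (Fin n → F) :=
  LinearEquiv.ofBijective
    { toFun := fun a j => a.1 0 j.succ
      map_add' := fun _ _ => rfl
      map_smul' := fun _ _ => rfl } <| by
    constructor
    · rw [← LinearMap.ker_eq_bot, LinearMap.ker_eq_bot']
      rintro a ha
      refine Subtype.ext (hR.eq_zero_of_commute
        ((mem_subOne_iff hR hA).1 ((mem_nilAlgebra hR hA).1 a.2)).1 ?_)
      ext j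
      refine Fin.cases (nilAlgebra_col_zero hR hA a 0) (fun j => congrFun ha j) j
    · intro v
      obtain ⟨r, ⟨hr, hv⟩, -⟩ := hR v
      refine ⟨⟨mat r - 1, (mem_nilAlgebra hR hA).2 ⟨r, hr, rfl⟩⟩, ?_⟩
      ext j
      change mat r 0 j.succ - (1 : Matrix _ _ F) 0 j.succ = v j
      simp [hv, (Fin.succ_ne_zero j).symm]

theorem rowEquiv_apply (hR : IsRegular R) (hA : IsAbelian R) (a : nilAlgebra R) (j : Fin n) :
    rowEquiv hR hA a j = a.1 0 j.succ := rfl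

theorem row_eq_vecCons (hR : IsRegular R) (hA : IsAbelian R) (a : nilAlgebra R) :
    a.1 0 = vecCons 0 (rowEquiv hR hA a) := by
  ext j
  refine Fin.cases (nilAlgebra_col_zero hR hA a 0) (fun j => rfl) j

theorem finrank_nilAlgebra (hR : IsRegular R) (hA : IsAbelian R) :
    Module.finrank F (nilAlgebra R) = n := by
  rw [(rowEquiv hR hA).finrank_eq, Module.finrank_fin_fun]

/-- The quasi-inverse of $r-1$ is $r^{-1}-1$. -/
theorem isNilpotentAlgebra_nilAlgebra (hR : IsRegular R) (hA : IsAbelian R) :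
    IsNilpotentAlgebra (nilAlgebra R) := by
  have : Module.Finite F (nilAlgebra R) := Module.Finite.equiv (rowEquiv hR hA).symm
  refine isNilpotentAlgebra_of_quasiregular F (nilAlgebra_mul_comm hR hA) ?_
  rintro ⟨a, ha⟩
  rw [mem_nilAlgebra hR hA] at ha
  obtain ⟨r, hr, rfl⟩ := ha
  refine ⟨⟨mat r⁻¹ - 1, (mem_nilAlgebra hR hA).2 ⟨_, R.inv_mem hr, rfl⟩⟩, Subtype.ext ?_⟩
  change (mat r - 1) + (mat r⁻¹ - 1) + (mat r - 1) * (mat r⁻¹ - 1) = 0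
  have := mat_mul_mat_inv r
  rw [sub_mul, mul_sub, this]
  noncomm_ring

theorem algIsomorphic_of_areConj (hR : IsRegular R) (hA : IsAbelian R) (hS : IsRegular S)
    (hB : IsAbelian S) (h : AreConj R S) : AlgIsomorphic F (nilAlgebra R) (nilAlgebra S) := by
  obtain ⟨g, rfl⟩ := h
  have h1 := mat_mul_mat_inv g
  have h2 := mat_inv_mul_mat g
  have hto : ∀ a ∈ nilAlgebra R, mat g * a * mat g⁻¹ ∈
      nilAlgebra (R.map (MulAut.conj g).toMonoidHom) := by
    intro a ha
    rw [mem_nilAlgebra hR hA] at ha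
    obtain ⟨r, hr, rfl⟩ := ha
    refine (mem_nilAlgebra hS hB).2 ⟨g * r * g⁻¹, ⟨r, hr, rfl⟩, ?_⟩
    rw [mat_mul, mat_mul, mul_sub, sub_mul, mul_one, h1]
  have hinv : ∀ b ∈ nilAlgebra (R.map (MulAut.conj g).toMonoidHom),
      mat g⁻¹ * b * mat g ∈ nilAlgebra R := by
    intro b hb
    rw [mem_nilAlgebra hS hB] at hb
    obtain ⟨_, ⟨r, hr, rfl⟩, rfl⟩ := hb
    refine (mem_nilAlgebra hR hA).2 ⟨r, hr, ?_⟩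
    change mat g⁻¹ * (mat g * mat r * mat g⁻¹ - 1) * mat g = mat r - 1
    simp only [mul_sub, sub_mul, mul_one, mul_assoc, h2]
    simp only [← mul_assoc, h2, one_mul]
  have hmm : ∀ m : Matrix (Fin (n + 1)) (Fin (n + 1)) F, mat g⁻¹ * (mat g * m) = m := fun m => by
    rw [← mul_assoc, h2, one_mul]
  have hmm' : ∀ m : Matrix (Fin (n + 1)) (Fin (n + 1)) F, mat g * (mat g⁻¹ * m) = m := fun m => by
    rw [← mul_assoc, h1, one_mul]
  refine ⟨{ toFun := fun a => ⟨mat g * a.1 * mat g⁻¹, hto _ a.2⟩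
            invFun := fun b => ⟨mat g⁻¹ * b.1 * mat g, hinv _ b.2⟩
            map_add' := fun a b => Subtype.ext ?_
            map_smul' := fun c a => Subtype.ext ?_
            left_inv := fun a => Subtype.ext ?_
            right_inv := fun b => Subtype.ext ?_ }, fun a b => Subtype.ext ?_⟩
  · change mat g * (a.1 + b.1) * mat g⁻¹ = mat g * a.1 * mat g⁻¹ + mat g * b.1 * mat g⁻¹
    rw [mul_add, add_mul]
  · change mat g * (c • a.1) * mat g⁻¹ = c • (mat g * a.1 * mat g⁻¹)
    rw [mul_smul_comm, smul_mul_assoc]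
  · change mat g⁻¹ * (mat g * a.1 * mat g⁻¹) * mat g = a.1
    simp only [mul_assoc, hmm, h2, mul_one]
  · change mat g * (mat g⁻¹ * b.1 * mat g) * mat g⁻¹ = b.1
    simp only [mul_assoc, hmm', h1, mul_one]
  · change mat g * (a.1 * b.1) * mat g⁻¹ = mat g * a.1 * mat g⁻¹ * (mat g * b.1 * mat g⁻¹)
    simp only [mul_assoc, hmm]

/-- The linear automorphism `(c, v) ↦ (c, L v)` of the space of row vectors. -/
def extendLinear (L : (Fin n → F) →ₗ[F] (Fin n → F)) :
    (Fin (n + 1) → F) →ₗ[F] (Fin (n + 1) → F) where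
  toFun w := vecCons (w 0) (L (vecTail w))
  map_add' v w := by
    rw [show vecTail (v + w) = vecTail v + vecTail w from rfl, map_add]
    simp
  map_smul' c w := by
    rw [show vecTail (c • w) = c • vecTail w from rfl, map_smul]
    simp

theorem extendLinear_vecCons (L : (Fin n → F) →ₗ[F] (Fin n → F)) (c : F) (v : Fin n → F) :
    extendLinear L (vecCons c v) = vecCons c (L v) := rfl

/-- Read on first rows, $f$ becomes a linear map $L$ of $F^n$; let $G$ be its extension fixing
$e_0$, acting on row vectors. Then $aG=Gf(a)$ for all $a$: both sides agree on $e_0$ by the choice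
of $L$, and on the first row of any $b$ because that row times $a$ is the first row of $ba$ and $f$
is multiplicative. These vectors span. -/
theorem areConj_of_algIsomorphic (hR : IsRegular R) (hA : IsAbelian R) (hS : IsRegular S)
    (hB : IsAbelian S) (h : AlgIsomorphic F (nilAlgebra R) (nilAlgebra S)) : AreConj R S := by
  obtain ⟨f, hf⟩ := h
  let L : (Fin n → F) ≃ₗ[F] (Fin n → F) := (rowEquiv hR hA).symm ≪≫ₗ f ≪≫ₗ rowEquiv hS hB
  have hL : ∀ a, L (rowEquiv hR hA a) = rowEquiv hS hB (f a) := fun a => by simp [L]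
  have hrow : ∀ a : nilAlgebra R, extendLinear (L : (Fin n → F) →ₗ[F] (Fin n → F)) (a.1 0) =
      (f a).1 0 := by
    intro a
    rw [row_eq_vecCons hR hA, extendLinear_vecCons, row_eq_vecCons hS hB]
    congr 1
    exact hL a
  let G : Matrix (Fin (n + 1)) (Fin (n + 1)) F := Matrix.of fun i =>
    extendLinear (L : (Fin n → F) →ₗ[F] (Fin n → F)) (Pi.single i 1)
  let G' : Matrix (Fin (n + 1)) (Fin (n + 1)) F := Matrix.of fun i =>
    extendLinear (L.symm : (Fin n → F) →ₗ[F] (Fin n → F)) (Pi.single i 1)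
  have hG : ∀ w, w ᵥ* G = extendLinear (L : (Fin n → F) →ₗ[F] (Fin n → F)) w := by
    intro w
    conv_rhs => rw [pi_eq_sum_univ' w, map_sum]
    rw [Matrix.vecMul_eq_sum]
    refine Finset.sum_congr rfl fun i _ => ?_
    rw [map_smul]
    rfl
  have hG' : ∀ w, w ᵥ* G' = extendLinear (L.symm : (Fin n → F) →ₗ[F] (Fin n → F)) w := by
    intro w
    conv_rhs => rw [pi_eq_sum_univ' w, map_sum]
    rw [Matrix.vecMul_eq_sum]
    refine Finset.sum_congr rfl fun i _ => ?_
    rw [map_smul]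
    rfl
  have hcons : ∀ w : Fin (n + 1) → F, ∃ (c : F) (a : nilAlgebra R), w = c • Pi.single 0 1 + a.1 0 := by
    intro w
    refine ⟨w 0, (rowEquiv hR hA).symm (vecTail w), ?_⟩
    rw [row_eq_vecCons hR hA, LinearEquiv.apply_symm_apply]
    ext j
    refine Fin.cases ?_ (fun j => ?_) j
    · simp
    · simp [vecTail]
  have hGG' : G * G' = 1 := by
    refine Matrix.ext_of_single_vecMul fun i => ?_
    rw [← Matrix.vecMul_vecMul, hG, hG', vecMul_one]
    conv_rhs => rw [← Matrix.cons_head_tail (Pi.single i 1 : Fin (n + 1) → F)]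
    change vecCons _ (L.symm (L _)) = _
    rw [LinearEquiv.symm_apply_apply]
    rfl
  have hG'G : G' * G = 1 := mul_eq_one_comm.1 hGG'
  have he0 : extendLinear (L : (Fin n → F) →ₗ[F] (Fin n → F)) (Pi.single 0 1) = Pi.single 0 1 := by
    have : (Pi.single 0 1 : Fin (n + 1) → F) = vecCons 1 0 := by
      ext j; refine Fin.cases ?_ (fun j => ?_) j <;> simp
    rw [this, extendLinear_vecCons, map_zero]
  have hcomm : ∀ a : nilAlgebra R, a.1 * G = G * (f a).1 := by
    intro a
    refine Matrix.ext_of_single_vecMul fun i => ?_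
    rw [← Matrix.vecMul_vecMul, ← Matrix.vecMul_vecMul, hG, hG]
    obtain ⟨c, b, hb⟩ := hcons (Pi.single i 1)
    rw [hb, map_add, map_smul, he0, add_vecMul, add_vecMul, smul_vecMul, smul_vecMul,
      ← row_zero_mul, hrow b, ← row_zero_mul, map_add, map_smul]
    have h1 := hrow (b * a)
    rw [hf] at h1
    change extendLinear _ ((b.1 * a.1) 0) = ((f b).1 * (f a).1) 0 at h1
    rw [h1]
    congr 2
    simp only [Matrix.single_one_vecMul]
    exact hrow a
  -- The conjugator is $G'=G^{-1}$, since $aG=Gf(a)$ reads $G^{-1}aG=f(a)$.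
  let g : AGL n F := ⟨⟨G', G, hG'G, hGG'⟩, fun i => by
    change (Pi.single i 1 : Fin (n + 1) → F) 0 = _
    rw [Pi.single_apply]
    exact if_congr eq_comm rfl rfl⟩
  have hg : mat g = G' := rfl
  have hgi : mat g⁻¹ = G := rfl
  have key : ∀ a : nilAlgebra R, ∀ r s : AGL n F, a.1 = mat r - 1 → (f a).1 = mat s - 1 →
      g * r * g⁻¹ = s := by
    intro a r s hr hs
    apply mat_injective
    rw [mat_mul, mat_mul, hg, hgi, show mat r = a.1 + 1 by rw [hr, sub_add_cancel],
      show mat s = (f a).1 + 1 by rw [hs, sub_add_cancel], mul_assoc, add_mul, one_mul, hcomm,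
      mul_add, hG'G, ← mul_assoc, hG'G, one_mul]
  refine ⟨g, ?_⟩
  ext s
  constructor
  · rintro ⟨r, hr, rfl⟩
    let a : nilAlgebra R := ⟨mat r - 1, (mem_nilAlgebra hR hA).2 ⟨r, hr, rfl⟩⟩
    obtain ⟨s, hs, hfs⟩ := (mem_nilAlgebra hS hB).1 (f a).2
    change g * r * g⁻¹ ∈ S
    rw [key a r s rfl hfs]
    exact hs
  · intro hs
    let c : nilAlgebra S := ⟨mat s - 1, (mem_nilAlgebra hS hB).2 ⟨s, hs, rfl⟩⟩
    obtain ⟨r, hr, hfr⟩ := (mem_nilAlgebra hR hA).1 (f.symm c).2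
    refine ⟨r, hr, key (f.symm c) r s hfr ?_⟩
    rw [LinearEquiv.apply_symm_apply]

end AGL

/-! ### The twelve representatives as products on ℝ⁴ -/

/-- `m` and `m'` are products on real vector spaces that correspond under a linear isomorphism. -/
def ProdIso {V W : Type*} [AddCommGroup V] [Module ℝ V] [AddCommGroup W] [Module ℝ W]
    (m : V → V → V) (m' : W → W → W) : Prop :=
  ∃ e : V ≃ₗ[ℝ] W, ∀ x y, e (m x y) = m' (e x) (e y)

section ProdIso

variable {V W U : Type*} [AddCommGroup V] [Module ℝ V] [AddCommGroup W] [Module ℝ W]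
  [AddCommGroup U] [Module ℝ U] {m : V → V → V} {m' : W → W → W} {m'' : U → U → U}

theorem ProdIso.symm (h : ProdIso m m') : ProdIso m' m := by
  obtain ⟨e, he⟩ := h
  exact ⟨e.symm, fun x y => e.injective (by simp [he])⟩

theorem ProdIso.trans (h : ProdIso m m') (h' : ProdIso m' m'') : ProdIso m m'' := by
  obtain ⟨e, he⟩ := h
  obtain ⟨f, hf⟩ := h'
  exact ⟨e.trans f, fun x y => by simp [he, hf]⟩

end ProdIso

namespace AGL

section OfForm

variable {n : ℕ} {F : Type*} [Field F] {M : (Fin n → F) → Matrix (Fin (n + 1)) (Fin (n + 1)) F}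
  {hone : ∃ x, M x = 1} {hmul : ∀ x y, ∃ z, M x * M y = M z} {hinv : ∀ x, ∃ y, M x * M y = 1}

theorem isRegular_ofForm (hrow : ∀ x, M x 0 = vecCons 1 x)
    (hcol : ∀ x i, M x i 0 = if i = 0 then 1 else 0) : IsRegular (ofForm M hone hmul hinv) := by
  intro v
  obtain ⟨w, hw⟩ := hinv v
  refine ⟨⟨⟨M v, M w, hw, mul_eq_one_comm.1 hw⟩, hcol v⟩, ⟨⟨v, rfl⟩, hrow v⟩, ?_⟩
  rintro r ⟨⟨x, hx⟩, hr⟩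
  rw [hx, hrow] at hr
  obtain ⟨-, rfl⟩ := Matrix.vecCons_inj.1 hr
  exact mat_injective hx

theorem isAbelian_ofForm (hcomm : ∀ x y, M x * M y = M y * M x) :
    IsAbelian (ofForm M hone hmul hinv) := by
  rintro r ⟨x, hx⟩ s ⟨y, hy⟩
  apply mat_injective
  rw [mat_mul, mat_mul, hx, hy, hcomm]

/-- The first row of $ab$ is the first row of $a$ times $b$, and $b=M(y)-1$ where $y$ is the first
row of $b$. So the product on $F^n$ can be read off from the parametrization. -/
theorem rowEquiv_mul_ofForm (hrow : ∀ x, M x 0 = vecCons 1 x)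
    (hR : IsRegular (ofForm M hone hmul hinv)) (hA : IsAbelian (ofForm M hone hmul hinv))
    (a b : nilAlgebra (ofForm M hone hmul hinv)) (j : Fin n) :
    rowEquiv hR hA (a * b) j =
      ∑ i, rowEquiv hR hA a i * (M (rowEquiv hR hA b) - 1) i.succ j.succ := by
  obtain ⟨s, ⟨y, hy⟩, hs⟩ := (mem_nilAlgebra hR hA).1 b.2
  have hby : rowEquiv hR hA b = y := by
    ext k
    rw [rowEquiv_apply, hs, hy, Matrix.sub_apply, hrow]
    simp [(Fin.succ_ne_zero k).symm]
  rw [hby, ← hy, ← hs, rowEquiv_apply]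
  change (a.1 * b.1) 0 j.succ = _
  rw [Matrix.mul_apply, Fin.sum_univ_succ, nilAlgebra_col_zero hR hA, zero_mul, zero_add]
  rfl

end OfForm

/-- The product of `ℝ⁴` that corresponds to `S_(5)`. -/
def prodS5 (x y : Fin 4 → ℝ) : Fin 4 → ℝ :=
  ![0, x 0 * y 0, x 0 * y 1 + x 1 * y 0, x 0 * y 2 + x 1 * y 1 + x 2 * y 0]

/-- The product of `ℝ⁴` that corresponds to `S_(4,1)`. -/
def prodS41 (x y : Fin 4 → ℝ) : Fin 4 → ℝ :=
  ![0, x 0 * y 0, x 0 * y 1 + x 1 * y 0, 0]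

/-- The product of `ℝ⁴` that corresponds to `S_(3,2)^♯`. -/
def prodS32 (x y : Fin 4 → ℝ) : Fin 4 → ℝ :=
  ![0, x 0 * y 0, 0, x 0 * y 1 + x 1 * y 0 + x 2 * y 2]

/-- The product of `ℝ⁴` that corresponds to `U_1(0, β)`. -/
def prodU1 (β : ℝ) (x y : Fin 4 → ℝ) : Fin 4 → ℝ :=
  ![0, 0, x 0 * y 0 + β * (x 1 * y 1), x 0 * y 1 + x 1 * y 0]

/-- The product of `ℝ⁴` that corresponds to `R_D`, where `D` is diagonal. -/
def prodRD (a b c : ℝ) (x y : Fin 4 → ℝ) : Fin 4 → ℝ :=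
  ![0, 0, 0, a * (x 0 * y 0) + b * (x 1 * y 1) + c * (x 2 * y 2)]

/-- The products of `ℝ⁴` that correspond to the twelve representatives. -/
def realProd : Fin 12 → (Fin 4 → ℝ) → (Fin 4 → ℝ) → (Fin 4 → ℝ) :=
  ![prodS5, prodS41, prodS32, prodU1 0, prodU1 1, prodU1 (-1),
    prodRD 1 0 0, prodRD 1 1 0, prodRD 1 (-1) 0, prodRD 1 1 (-1), prodRD 1 1 1, prodRD 0 0 0]

/-- `R` is an abelian regular subgroup whose algebra `R - I` is isomorphic to `ℝ⁴` with the
product `m`. -/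
def Realizes (R : Subgroup (AGL 4 ℝ)) (m : (Fin 4 → ℝ) → (Fin 4 → ℝ) → (Fin 4 → ℝ)) : Prop :=
  IsRegular R ∧ IsAbelian R ∧ ProdIso (fun x y : nilAlgebra R => x * y) m

theorem realizes_ofForm {M : (Fin 4 → ℝ) → Matrix (Fin 5) (Fin 5) ℝ}
    {hone : ∃ x, M x = 1} {hmul : ∀ x y, ∃ z, M x * M y = M z} {hinv : ∀ x, ∃ y, M x * M y = 1}
    {m : (Fin 4 → ℝ) → (Fin 4 → ℝ) → (Fin 4 → ℝ)} (hrow : ∀ x, M x 0 = vecCons 1 x)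
    (hcol : ∀ x i, M x i 0 = if i = 0 then 1 else 0) (hcomm : ∀ x y, M x * M y = M y * M x)
    (hm : ∀ x y j, ∑ i, x i * (M y - 1) i.succ j.succ = m x y j) :
    Realizes (ofForm M hone hmul hinv) m := by
  have hR := isRegular_ofForm (hone := hone) (hmul := hmul) (hinv := hinv) hrow hcol
  have hA := isAbelian_ofForm (hone := hone) (hmul := hmul) (hinv := hinv) hcomm
  refine ⟨hR, hA, rowEquiv hR hA, fun a b => funext fun j => ?_⟩
  rw [rowEquiv_mul_ofForm hrow, hm]

theorem realizes_S5 : Realizes (S5 ℝ) prodS5 := by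
  refine realizes_ofForm (fun x => ?_) (fun x i => ?_) (fun x y => ?_) (fun x y j => ?_)
  · ext j; fin_cases j <;> simp [formS5]
  · fin_cases i <;> simp [formS5]
  · simp [formS5]
    constructorm* _ ∧ _ <;> ring
  · fin_cases j <;> simp [formS5, prodS5, Fin.sum_univ_four, Matrix.one_apply]

theorem realizes_S41 : Realizes (S41 ℝ) prodS41 := by
  refine realizes_ofForm (fun x => ?_) (fun x i => ?_) (fun x y => ?_) (fun x y j => ?_)
  · ext j; fin_cases j <;> simp [formS41]
  · fin_cases i <;> simp [formS41]
  · simp [formS41]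
    constructorm* _ ∧ _ <;> ring
  · fin_cases j <;> simp [formS41, prodS41, Fin.sum_univ_four, Matrix.one_apply]

theorem realizes_S32 : Realizes (S32 ℝ) prodS32 := by
  refine realizes_ofForm (fun x => ?_) (fun x i => ?_) (fun x y => ?_) (fun x y j => ?_)
  · ext j; fin_cases j <;> simp [formS32]
  · fin_cases i <;> simp [formS32]
  · simp [formS32]
    constructorm* _ ∧ _ <;> ring
  · fin_cases j <;> simp [formS32, prodS32, Fin.sum_univ_four, Matrix.one_apply]

theorem realizes_U1 (β : ℝ) : Realizes (U1 0 β) (prodU1 β) := by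
  refine realizes_ofForm (fun x => ?_) (fun x i => ?_) (fun x y => ?_) (fun x y j => ?_)
  · ext j; fin_cases j <;> simp [formU1]
  · fin_cases i <;> simp [formU1]
  · simp [formU1]
    constructorm* _ ∧ _ <;> ring
  · fin_cases j <;> simp [formU1, prodU1, Fin.sum_univ_four, Matrix.one_apply]
    ring

theorem realizes_RD {D : Matrix (Fin 3) (Fin 3) ℝ} {d : Fin 3 → ℝ} (hD : D = diagonal d) :
    Realizes (RD D) (prodRD (d 0) (d 1) (d 2)) := by
  subst hD
  refine realizes_ofForm (fun x => ?_) (fun x i => ?_) (fun x y => ?_) (fun x y j => ?_)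
  · ext j; fin_cases j <;> simp [formR]
  · fin_cases i <;> simp [formR]
  · simp [formR]
    constructorm* _ ∧ _ <;> ring
  · fin_cases j <;> simp [formR, prodRD, Fin.sum_univ_four, Matrix.one_apply]
    ring

theorem realizes_Tr4 : Realizes (Tr4 ℝ) (prodRD 0 0 0) := by
  refine realizes_ofForm (fun x => ?_) (fun x i => ?_) (fun x y => ?_) (fun x y j => ?_)
  · ext j; fin_cases j <;> simp [formTr]
  · fin_cases i <;> simp [formTr]
  · simp [formTr]
    constructorm* _ ∧ _ <;> ring
  · fin_cases j <;> simp [formTr, prodRD, Fin.sum_univ_four, Matrix.one_apply]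

theorem realizes_realRep (i : Fin 12) : Realizes (realRep i) (realProd i) := by
  have hdiag : ∀ {D : Matrix (Fin 3) (Fin 3) ℝ} (a b c : ℝ), D = diagonal ![a, b, c] →
      Realizes (RD D) (prodRD a b c) := fun a b c h => realizes_RD h
  fin_cases i
  · exact realizes_S5
  · exact realizes_S41
  · exact realizes_S32
  · exact realizes_U1 0
  · exact realizes_U1 1
  · exact realizes_U1 (-1)
  · refine hdiag 1 0 0 ?_
    ext i j; fin_cases i <;> fin_cases j <;> simp [E]
  · refine hdiag 1 1 0 ?_
    ext i j; fin_cases i <;> fin_cases j <;> simp [E]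
  · refine hdiag 1 (-1) 0 ?_
    ext i j; fin_cases i <;> fin_cases j <;> simp [E]
  · refine hdiag 1 1 (-1) ?_
    ext i j; fin_cases i <;> fin_cases j <;> simp [E]
  · refine hdiag 1 1 1 ?_
    ext i j; fin_cases i <;> fin_cases j <;> simp
  · exact realizes_Tr4

end AGL

/-! ### Isomorphism invariants -/

section Invariants

variable {V W : Type*} [AddCommGroup V] [Module ℝ V] [AddCommGroup W] [Module ℝ W]

/-- Some element has a nonzero fourth power. -/
def HasFourthPower (m : V → V → V) : Prop := ∃ x, m (m x x) (m x x) ≠ 0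

/-- Some element has a nonzero cube. -/
def HasCube (m : V → V → V) : Prop := ∃ x, m (m x x) x ≠ 0

/-- All products vanish. -/
def IsZeroProd (m : V → V → V) : Prop := ∀ x y, m x y = 0

/-- All products lie on one line. -/
def ProdInLine (m : V → V → V) : Prop := ∃ z, ∀ x y, ∃ c : ℝ, m x y = c • z

/-- `a` lies in the annihilator. -/
def InAnn (m : V → V → V) (a : V) : Prop := ∀ x, m a x = 0

/-- The annihilator is contained in a line. -/
def AnnInLine (m : V → V → V) : Prop := ∃ z, ∀ a, InAnn m a → ∃ c : ℝ, a = c • z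

/-- Some element outside of the annihilator has square zero. -/
def HasSquareZero (m : V → V → V) : Prop := ∃ x, ¬ InAnn m x ∧ m x x = 0

/-- Some two elements outside of the annihilator have product zero. -/
def HasZeroDivisors (m : V → V → V) : Prop :=
  ∃ x y, ¬ InAnn m x ∧ ¬ InAnn m y ∧ m x y = 0

variable {m : V → V → V} {m' : W → W → W}

theorem inAnn_apply_iff {e : V ≃ₗ[ℝ] W} (he : ∀ x y, e (m x y) = m' (e x) (e y)) {a : V} :
    InAnn m' (e a) ↔ InAnn m a := by
  refine ⟨fun h x => e.injective ?_, fun h y => ?_⟩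
  · rw [he, h, map_zero]
  · obtain ⟨x, rfl⟩ := e.surjective y
    rw [← he, h, map_zero]

theorem ProdIso.hasFourthPower (h : ProdIso m m') : HasFourthPower m → HasFourthPower m' := by
  obtain ⟨e, he⟩ := h
  rintro ⟨x, hx⟩
  exact ⟨e x, by rwa [← he, ← he, Ne, e.map_eq_zero_iff]⟩

theorem ProdIso.hasCube (h : ProdIso m m') : HasCube m → HasCube m' := by
  obtain ⟨e, he⟩ := h
  rintro ⟨x, hx⟩
  exact ⟨e x, by rwa [← he, ← he, Ne, e.map_eq_zero_iff]⟩

theorem ProdIso.isZeroProd (h : ProdIso m m') : IsZeroProd m → IsZeroProd m' := by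
  obtain ⟨e, he⟩ := h
  intro hm x y
  obtain ⟨x, rfl⟩ := e.surjective x
  obtain ⟨y, rfl⟩ := e.surjective y
  rw [← he, hm, map_zero]

theorem ProdIso.prodInLine (h : ProdIso m m') : ProdInLine m → ProdInLine m' := by
  obtain ⟨e, he⟩ := h
  rintro ⟨z, hz⟩
  refine ⟨e z, fun x y => ?_⟩
  obtain ⟨x, rfl⟩ := e.surjective x
  obtain ⟨y, rfl⟩ := e.surjective y
  obtain ⟨c, hc⟩ := hz x y
  exact ⟨c, by rw [← he, hc, map_smul]⟩

theorem ProdIso.annInLine (h : ProdIso m m') : AnnInLine m → AnnInLine m' := by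
  obtain ⟨e, he⟩ := h
  rintro ⟨z, hz⟩
  refine ⟨e z, fun a ha => ?_⟩
  obtain ⟨a, rfl⟩ := e.surjective a
  obtain ⟨c, hc⟩ := hz a ((inAnn_apply_iff he).1 ha)
  exact ⟨c, by rw [hc, map_smul]⟩

theorem ProdIso.hasSquareZero (h : ProdIso m m') : HasSquareZero m → HasSquareZero m' := by
  obtain ⟨e, he⟩ := h
  rintro ⟨x, hx, hxx⟩
  exact ⟨e x, by rwa [inAnn_apply_iff he], by rw [← he, hxx, map_zero]⟩

theorem ProdIso.hasZeroDivisors (h : ProdIso m m') : HasZeroDivisors m → HasZeroDivisors m' := by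
  obtain ⟨e, he⟩ := h
  rintro ⟨x, y, hx, hy, hxy⟩
  exact ⟨e x, e y, by rwa [inAnn_apply_iff he], by rwa [inAnn_apply_iff he], by
    rw [← he, hxy, map_zero]⟩

open Classical in
/-- The index of the representative that a product is isomorphic to, read off from invariants. -/
noncomputable def prodIndex (m : V → V → V) : Fin 12 :=
  if HasFourthPower m then 0
  else if HasCube m then (if AnnInLine m then 2 else 1)
  else if IsZeroProd m then 11
  -- On the models of this branch the product is a quadratic form modulo its radical: absence of
  -- zero divisors means rank 1, annihilator in a line means rank 3, and a square-zero element
  -- outside the annihilator means indefinite.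
  else if ProdInLine m then
    (if ¬ HasZeroDivisors m then 6
    else if AnnInLine m then (if HasSquareZero m then 9 else 10)
    else (if HasSquareZero m then 8 else 7))
  -- Modulo the annihilator, `prodU1 β` is the multiplication of $\mathbb R[t]/(t^2-\beta)$: complex
  -- numbers for $\beta=-1$, dual numbers for $\beta=0$, and $\mathbb R\times\mathbb R$ for
  -- $\beta=1$.
  else if ¬ HasZeroDivisors m then 5
  else if HasSquareZero m then 3 else 4

/-- Each of the seven predicates in the tree is carried along an isomorphism, and along its inverse.
-/
theorem ProdIso.prodIndex_eq (h : ProdIso m m') : prodIndex m = prodIndex m' := by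
  unfold prodIndex
  rw [propext ⟨h.hasFourthPower, h.symm.hasFourthPower⟩, propext ⟨h.hasCube, h.symm.hasCube⟩,
    propext ⟨h.isZeroProd, h.symm.isZeroProd⟩, propext ⟨h.prodInLine, h.symm.prodInLine⟩,
    propext ⟨h.annInLine, h.symm.annInLine⟩, propext ⟨h.hasSquareZero, h.symm.hasSquareZero⟩,
    propext ⟨h.hasZeroDivisors, h.symm.hasZeroDivisors⟩]

end Invariants

/-! ### The invariants of the twelve models -/

namespace AGL

theorem not_line_of_basis {z : Fin 4 → ℝ} {i j : Fin 4} (hij : i ≠ j)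
    (hi : ∃ c : ℝ, Pi.single i 1 = c • z) (hj : ∃ c : ℝ, Pi.single j 1 = c • z) : False := by
  obtain ⟨c, hc⟩ := hi
  obtain ⟨d, hd⟩ := hj
  have h1 := congrFun hc i
  have h2 := congrFun hc j
  have h3 := congrFun hd j
  simp only [Pi.single_eq_same, Pi.single_eq_of_ne hij.symm, Pi.smul_apply, smul_eq_mul] at h1 h2 h3
  have hc0 : c ≠ 0 := fun h => by simp [h] at h1
  have hz : z j = 0 := by simpa [hc0] using h2.symm
  simp [hz] at h3

theorem hasFourthPower_prodS5 : HasFourthPower prodS5 :=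
  ⟨![1, 0, 0, 0], fun h => by simpa [prodS5] using congrFun h 3⟩

theorem not_hasFourthPower_prodS41 : ¬ HasFourthPower prodS41 := by
  rintro ⟨x, hx⟩
  exact hx (by ext i; fin_cases i <;> simp [prodS41])

theorem hasCube_prodS41 : HasCube prodS41 :=
  ⟨![1, 0, 0, 0], fun h => by simpa [prodS41] using congrFun h 2⟩

theorem not_annInLine_prodS41 : ¬ AnnInLine prodS41 := by
  rintro ⟨z, hz⟩
  refine not_line_of_basis (z := z) (i := 2) (j := 3) (by decide) (hz _ fun x => ?_)
    (hz _ fun x => ?_) <;> ext i <;> fin_cases i <;> simp [prodS41]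

theorem not_hasFourthPower_prodS32 : ¬ HasFourthPower prodS32 := by
  rintro ⟨x, hx⟩
  exact hx (by ext i; fin_cases i <;> simp [prodS32])

theorem hasCube_prodS32 : HasCube prodS32 :=
  ⟨![1, 0, 0, 0], fun h => by simpa [prodS32] using congrFun h 3⟩

theorem annInLine_prodS32 : AnnInLine prodS32 := by
  refine ⟨Pi.single 3 1, fun a ha => ⟨a 3, ?_⟩⟩
  have h0 := congrFun (ha (Pi.single 1 1)) 3
  have h1 := congrFun (ha (Pi.single 0 1)) 3
  have h2 := congrFun (ha (Pi.single 2 1)) 3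
  simp [prodS32] at h0 h1 h2
  ext i; fin_cases i <;> simp [h0, h1, h2]

theorem inAnn_prodU1_iff {β : ℝ} {a : Fin 4 → ℝ} : InAnn (prodU1 β) a ↔ a 0 = 0 ∧ a 1 = 0 := by
  constructor
  · intro ha
    have h0 := congrFun (ha (Pi.single 1 1)) 3
    have h1 := congrFun (ha (Pi.single 0 1)) 3
    simp [prodU1] at h0 h1
    exact ⟨h0, h1⟩
  · rintro ⟨h0, h1⟩ x
    ext i; fin_cases i <;> simp [prodU1, h0, h1]

theorem not_hasFourthPower_prodU1 (β : ℝ) : ¬ HasFourthPower (prodU1 β) := by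
  rintro ⟨x, hx⟩
  exact hx (by ext i; fin_cases i <;> simp [prodU1])

theorem not_hasCube_prodU1 (β : ℝ) : ¬ HasCube (prodU1 β) := by
  rintro ⟨x, hx⟩
  exact hx (by ext i; fin_cases i <;> simp [prodU1])

theorem not_prodInLine_prodU1 (β : ℝ) : ¬ ProdInLine (prodU1 β) := by
  rintro ⟨z, hz⟩
  refine not_line_of_basis (z := z) (i := 2) (j := 3) (by decide) ?_ ?_
  · convert hz (Pi.single 0 1) (Pi.single 0 1) using 3
    ext i; fin_cases i <;> simp [prodU1]
  · convert hz (Pi.single 0 1) (Pi.single 1 1) using 3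
    ext i; fin_cases i <;> simp [prodU1]

theorem not_isZeroProd_prodU1 (β : ℝ) : ¬ IsZeroProd (prodU1 β) := fun h =>
  not_prodInLine_prodU1 β ⟨0, fun x y => ⟨0, by rw [h, smul_zero]⟩⟩

theorem hasSquareZero_prodU1_zero : HasSquareZero (prodU1 0) := by
  refine ⟨![0, 1, 0, 0], by simp [inAnn_prodU1_iff], ?_⟩
  ext i; fin_cases i <;> simp [prodU1]

theorem not_hasSquareZero_prodU1_one : ¬ HasSquareZero (prodU1 1) := by
  rintro ⟨x, hx, hxx⟩
  have h := congrFun hxx 2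
  simp [prodU1] at h
  exact hx (inAnn_prodU1_iff.2 ⟨by nlinarith, by nlinarith⟩)

theorem hasZeroDivisors_of_hasSquareZero {m : (Fin 4 → ℝ) → (Fin 4 → ℝ) → (Fin 4 → ℝ)}
    (h : HasSquareZero m) : HasZeroDivisors m := by
  obtain ⟨x, hx, hxx⟩ := h
  exact ⟨x, x, hx, hx, hxx⟩

theorem hasZeroDivisors_prodU1_one : HasZeroDivisors (prodU1 1) := by
  -- This is $(1+t)(1-t)=0$ when $t^2=1$.
  refine ⟨![1, 1, 0, 0], ![1, -1, 0, 0], by simp [inAnn_prodU1_iff], by simp [inAnn_prodU1_iff], ?_⟩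
  ext i; fin_cases i <;> simp [prodU1]

theorem not_hasZeroDivisors_prodU1_neg_one : ¬ HasZeroDivisors (prodU1 (-1)) := by
  rintro ⟨x, y, hx, hy, hxy⟩
  have h2 := congrFun hxy 2
  have h3 := congrFun hxy 3
  simp [prodU1] at h2 h3
  -- Multiplicativity of the complex norm.
  have h : (x 0 ^ 2 + x 1 ^ 2) * (y 0 ^ 2 + y 1 ^ 2) = 0 := by
    linear_combination (x 0 * y 0 - x 1 * y 1) * h2 + (x 0 * y 1 + x 1 * y 0) * h3
  rcases mul_eq_zero.1 h with h | h
  · exact hx (inAnn_prodU1_iff.2 ⟨by nlinarith, by nlinarith⟩)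
  · exact hy (inAnn_prodU1_iff.2 ⟨by nlinarith, by nlinarith⟩)

theorem inAnn_prodRD_iff {a b c : ℝ} {x : Fin 4 → ℝ} :
    InAnn (prodRD a b c) x ↔ a * x 0 = 0 ∧ b * x 1 = 0 ∧ c * x 2 = 0 := by
  constructor
  · intro ha
    have h0 := congrFun (ha (Pi.single 0 1)) 3
    have h1 := congrFun (ha (Pi.single 1 1)) 3
    have h2 := congrFun (ha (Pi.single 2 1)) 3
    simp [prodRD] at h0 h1 h2
    simpa using ⟨h0, h1, h2⟩
  · rintro ⟨h0, h1, h2⟩ y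
    ext i; fin_cases i <;> simp [prodRD, ← mul_assoc, h0, h1, h2]

theorem not_hasFourthPower_prodRD (a b c : ℝ) : ¬ HasFourthPower (prodRD a b c) := by
  rintro ⟨x, hx⟩
  exact hx (by ext i; fin_cases i <;> simp [prodRD])

theorem not_hasCube_prodRD (a b c : ℝ) : ¬ HasCube (prodRD a b c) := by
  rintro ⟨x, hx⟩
  exact hx (by ext i; fin_cases i <;> simp [prodRD])

theorem isZeroProd_prodRD : IsZeroProd (prodRD 0 0 0) := fun x y => by
  ext i; fin_cases i <;> simp [prodRD]

theorem not_isZeroProd_prodRD (b c : ℝ) : ¬ IsZeroProd (prodRD 1 b c) := fun h => by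
  simpa [prodRD] using congrFun (h ![1, 0, 0, 0] ![1, 0, 0, 0]) 3

theorem prodInLine_prodRD (a b c : ℝ) : ProdInLine (prodRD a b c) := by
  refine ⟨Pi.single 3 1, fun x y => ⟨prodRD a b c x y 3, ?_⟩⟩
  ext i; fin_cases i <;> simp [prodRD]

theorem annInLine_prodRD {a b c : ℝ} (ha : a ≠ 0) (hb : b ≠ 0) (hc : c ≠ 0) :
    AnnInLine (prodRD a b c) := by
  refine ⟨Pi.single 3 1, fun x hx => ⟨x 3, ?_⟩⟩
  obtain ⟨h0, h1, h2⟩ := inAnn_prodRD_iff.1 hx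
  simp only [mul_eq_zero, ha, hb, hc, false_or] at h0 h1 h2
  ext i; fin_cases i <;> simp [h0, h1, h2]

theorem not_annInLine_prodRD (a b : ℝ) : ¬ AnnInLine (prodRD a b 0) := by
  rintro ⟨z, hz⟩
  exact not_line_of_basis (z := z) (i := 2) (j := 3) (by decide)
    (hz _ (by simp [inAnn_prodRD_iff])) (hz _ (by simp [inAnn_prodRD_iff]))

theorem not_hasZeroDivisors_prodRD : ¬ HasZeroDivisors (prodRD 1 0 0) := by
  rintro ⟨x, y, hx, hy, hxy⟩
  have h := congrFun hxy 3
  simp [prodRD] at h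
  rcases h with h | h
  · exact hx (by simp [inAnn_prodRD_iff, h])
  · exact hy (by simp [inAnn_prodRD_iff, h])

theorem hasZeroDivisors_prodRD {a b c : ℝ} (ha : a ≠ 0) (hb : b ≠ 0) :
    HasZeroDivisors (prodRD a b c) := by
  refine ⟨![1, 0, 0, 0], ![0, 1, 0, 0], by simp [inAnn_prodRD_iff, ha], by
    simp [inAnn_prodRD_iff, hb], ?_⟩
  ext i; fin_cases i <;> simp [prodRD]

theorem hasSquareZero_prodRD_one_neg_one : HasSquareZero (prodRD 1 (-1) 0) := by
  refine ⟨![1, 1, 0, 0], by simp [inAnn_prodRD_iff], ?_⟩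
  ext i; fin_cases i <;> simp [prodRD]

theorem hasSquareZero_prodRD_one_one_neg_one : HasSquareZero (prodRD 1 1 (-1)) := by
  refine ⟨![1, 0, 1, 0], by simp [inAnn_prodRD_iff], ?_⟩
  ext i; fin_cases i <;> simp [prodRD]

/-- A positive semidefinite diagonal form vanishes at $x$ only if each of its terms does, and then
$x$ is in the radical. -/
theorem not_hasSquareZero_prodRD {a b c : ℝ} (ha : 0 ≤ a) (hb : 0 ≤ b) (hc : 0 ≤ c) :
    ¬ HasSquareZero (prodRD a b c) := by
  rintro ⟨x, hx, hxx⟩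
  have h := congrFun hxx 3
  simp only [prodRD, Matrix.cons_val, Pi.zero_apply] at h
  have h0 := mul_nonneg ha (mul_self_nonneg (x 0))
  have h1 := mul_nonneg hb (mul_self_nonneg (x 1))
  have h2 := mul_nonneg hc (mul_self_nonneg (x 2))
  refine hx (inAnn_prodRD_iff.2 ⟨?_, ?_, ?_⟩)
  · have : a * (x 0 * x 0) = 0 := by linarith
    simpa using this
  · have : b * (x 1 * x 1) = 0 := by linarith
    simpa using this
  · have : c * (x 2 * x 2) = 0 := by linarith
    simpa using this

theorem prodIndex_realProd (i : Fin 12) : prodIndex (realProd i) = i := by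
  fin_cases i
  · change prodIndex prodS5 = 0
    simp [prodIndex, hasFourthPower_prodS5]
  · change prodIndex prodS41 = 1
    simp [prodIndex, not_hasFourthPower_prodS41, hasCube_prodS41, not_annInLine_prodS41]
  · change prodIndex prodS32 = 2
    simp [prodIndex, not_hasFourthPower_prodS32, hasCube_prodS32, annInLine_prodS32]
  · change prodIndex (prodU1 0) = 3
    simp [prodIndex, not_hasFourthPower_prodU1, not_hasCube_prodU1, not_isZeroProd_prodU1,
      not_prodInLine_prodU1, hasSquareZero_prodU1_zero,
      hasZeroDivisors_of_hasSquareZero hasSquareZero_prodU1_zero]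
  · change prodIndex (prodU1 1) = 4
    simp [prodIndex, not_hasFourthPower_prodU1, not_hasCube_prodU1, not_isZeroProd_prodU1,
      not_prodInLine_prodU1, not_hasSquareZero_prodU1_one, hasZeroDivisors_prodU1_one]
  · change prodIndex (prodU1 (-1)) = 5
    simp [prodIndex, not_hasFourthPower_prodU1, not_hasCube_prodU1, not_isZeroProd_prodU1,
      not_prodInLine_prodU1, not_hasZeroDivisors_prodU1_neg_one]
  · change prodIndex (prodRD 1 0 0) = 6
    simp [prodIndex, not_hasFourthPower_prodRD, not_hasCube_prodRD, not_isZeroProd_prodRD,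
      prodInLine_prodRD, not_hasZeroDivisors_prodRD]
  · change prodIndex (prodRD 1 1 0) = 7
    simp [prodIndex, not_hasFourthPower_prodRD, not_hasCube_prodRD, not_isZeroProd_prodRD,
      prodInLine_prodRD, hasZeroDivisors_prodRD, not_annInLine_prodRD, not_hasSquareZero_prodRD]
  · change prodIndex (prodRD 1 (-1) 0) = 8
    simp [prodIndex, not_hasFourthPower_prodRD, not_hasCube_prodRD, not_isZeroProd_prodRD,
      prodInLine_prodRD, hasZeroDivisors_prodRD, not_annInLine_prodRD,
      hasSquareZero_prodRD_one_neg_one]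
  · change prodIndex (prodRD 1 1 (-1)) = 9
    simp [prodIndex, not_hasFourthPower_prodRD, not_hasCube_prodRD, not_isZeroProd_prodRD,
      prodInLine_prodRD, hasZeroDivisors_prodRD, annInLine_prodRD,
      hasSquareZero_prodRD_one_one_neg_one]
  · change prodIndex (prodRD 1 1 1) = 10
    simp [prodIndex, not_hasFourthPower_prodRD, not_hasCube_prodRD, not_isZeroProd_prodRD,
      prodInLine_prodRD, hasZeroDivisors_prodRD, annInLine_prodRD, not_hasSquareZero_prodRD]
  · change prodIndex (prodRD 0 0 0) = 11
    simp [prodIndex, not_hasFourthPower_prodRD, not_hasCube_prodRD, isZeroProd_prodRD]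

end AGL

/-! ### Algebras with a nonzero cube -/

section Classification

variable {A : Type*} [NonUnitalCommRing A] [Module ℝ A]

/-- Four independent vectors are a basis, and `h` says that $m$ is the multiplication in its
coordinates. Every case with a nonzero product ends here, with an adapted basis. -/
theorem prodIso_of_linearIndependent (hdim : Module.finrank ℝ A = 4) {v : Fin 4 → A}
    (hv : LinearIndependent ℝ v) {m : (Fin 4 → ℝ) → (Fin 4 → ℝ) → (Fin 4 → ℝ)}
    (h : ∀ x y, ∑ i, m x y i • v i = (∑ i, x i • v i) * ∑ i, y i • v i) :
    ProdIso (fun x y : A => x * y) m := by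
  let b := basisOfLinearIndependentOfCardEqFinrank hv (by simp [hdim])
  have hb : ∀ x, b.equivFun.symm x = ∑ i, x i • v i := fun x => by
    simp [b, Module.Basis.equivFun_symm_apply]
  refine ProdIso.symm ⟨b.equivFun.symm, fun x y => ?_⟩
  rw [hb, hb, hb, h]

theorem exists_coords (hdim : Module.finrank ℝ A = 4) {v : Fin 4 → A}
    (hv : LinearIndependent ℝ v) (z : A) : ∃ c : Fin 4 → ℝ, z = ∑ i, c i • v i := by
  let b := basisOfLinearIndependentOfCardEqFinrank hv (by simp [hdim])
  refine ⟨b.equivFun z, ?_⟩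
  conv_lhs => rw [← b.sum_equivFun z]
  simp [b]

variable [IsScalarTower ℝ A A]

/-- In a nilpotent algebra multiplication operators have no nonzero eigenvalues. -/
theorem IsNilpotentAlgebra.eq_zero_of_mul_eq_smul (hA : IsNilpotentAlgebra A) {a x : A} {c : ℝ}
    (hc : c ≠ 0) (h : a * x = c • a) : a = 0 := by
  obtain ⟨k, hk⟩ := hA
  have key : ∀ n : ℕ, ∀ d : ℝ, (List.replicate n x).foldl (· * ·) (d • a) = (c ^ n * d) • a := by
    intro n
    induction n with
    | zero => intro d; simp
    | succ n ih =>
      intro d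
      rw [List.replicate_succ, List.foldl_cons, smul_mul_assoc, h, smul_smul, ih]
      congr 1
      ring
  have := key k 1
  rw [hk _ _ List.length_replicate] at this
  simpa [hc] using this.symm

variable [SMulCommClass ℝ A A]

/-- Nonzero elements of a nilpotent algebra, each of which divides the following ones, are
linearly independent. -/
theorem IsNilpotentAlgebra.linearIndependent_of_chain (hA : IsNilpotentAlgebra A) {n : ℕ}
    {v : Fin n → A} (h0 : ∀ i, v i ≠ 0) (h : ∀ i j, i < j → ∃ w, v j = v i * w) :
    LinearIndependent ℝ v := by
  rw [Fintype.linearIndependent_iff]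
  intro g hg i
  induction i using WellFoundedLT.induction with
  | ind i ih =>
    by_contra hi
    choose! w hw using h
    -- If $g_i$ is the first nonzero coefficient, the relation expresses $g_iv_i$ as a multiple of
    -- $v_i$ in the algebra, so $v_i$ would be an eigenvector with nonzero eigenvalue.
    refine h0 i (hA.eq_zero_of_mul_eq_smul (x := -∑ j, if i < j then g j • w i j else 0) hi ?_)
    rw [← Finset.add_sum_erase _ _ (Finset.mem_univ i)] at hg
    rw [mul_neg, Finset.mul_sum, ← Finset.add_sum_erase _ _ (Finset.mem_univ i), if_neg (lt_irrefl i),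
      mul_zero, zero_add, eq_comm, eq_neg_iff_add_eq_zero]
    refine Eq.trans ?_ hg
    congr 1
    refine Finset.sum_congr rfl fun j hj => ?_
    rcases lt_trichotomy i j with hij | hij | hij
    · rw [if_pos hij, mul_smul_comm, ← hw i j hij]
    · exact absurd hij.symm (Finset.ne_of_mem_erase hj)
    · rw [if_neg hij.not_gt, ih j hij, mul_zero, zero_smul]

/-- The powers $x,\dots,x^4$ form a divisibility chain, hence a basis; $x^5\neq0$ would give a fifth
independent vector. -/
theorem prodIso_prodS5 (hA : IsNilpotentAlgebra A) (hdim : Module.finrank ℝ A = 4) {x : A}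
    (hx : x * (x * (x * x)) ≠ 0) : ProdIso (fun x y : A => x * y) AGL.prodS5 := by
  have hfin : Module.Finite ℝ A := Module.finite_of_finrank_pos (by omega)
  have h3 : x * (x * x) ≠ 0 := fun h => hx (by rw [h, mul_zero])
  have h2 : x * x ≠ 0 := fun h => h3 (by rw [h, mul_zero])
  have h1 : x ≠ 0 := fun h => h2 (by rw [h, mul_zero])
  have h5 : x * (x * (x * (x * x))) = 0 := by
    by_contra h5
    have : LinearIndependent ℝ
        ![x, x * x, x * (x * x), x * (x * (x * x)), x * (x * (x * (x * x)))] := by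
      refine hA.linearIndependent_of_chain ?_ ?_
      · intro i; fin_cases i <;> assumption
      · intro i j hij
        fin_cases i <;> fin_cases j <;> simp at hij <;>
          first
          | (refine ⟨x, ?_⟩; simp [mul_assoc]; done)
          | (refine ⟨x * x, ?_⟩; simp [mul_assoc]; done)
          | (refine ⟨x * (x * x), ?_⟩; simp [mul_assoc]; done)
          | exact ⟨x * (x * (x * x)), rfl⟩
    have := this.fintype_card_le_finrank
    rw [hdim, Fintype.card_fin] at this
    omega
  have hv : LinearIndependent ℝ ![x, x * x, x * (x * x), x * (x * (x * x))] := by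
    refine hA.linearIndependent_of_chain ?_ ?_
    · intro i; fin_cases i <;> assumption
    · intro i j hij
      fin_cases i <;> fin_cases j <;> simp at hij <;>
        first
        | (refine ⟨x, ?_⟩; simp [mul_assoc]; done)
        | (refine ⟨x * x, ?_⟩; simp [mul_assoc]; done)
        | exact ⟨x * (x * x), rfl⟩
  refine prodIso_of_linearIndependent hdim hv fun p q => ?_
  simp only [Fin.sum_univ_four, AGL.prodS5, Matrix.cons_val, add_mul, mul_add, smul_mul_smul_comm,
    mul_assoc, h5, mul_zero, smul_zero]
  module

theorem linearIndependent_chain_snoc (hA : IsNilpotentAlgebra A) {x y : A} (hx : x * (x * x) ≠ 0)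
    (hy : ∀ a b c : ℝ, y ≠ a • x + b • (x * x) + c • (x * (x * x))) :
    LinearIndependent ℝ ![x, x * x, x * (x * x), y] := by
  have h2 : x * x ≠ 0 := fun h => hx (by rw [h, mul_zero])
  have h1 : x ≠ 0 := fun h => h2 (by rw [h, mul_zero])
  have hv : LinearIndependent ℝ ![x, x * x, x * (x * x)] := by
    refine hA.linearIndependent_of_chain ?_ ?_
    · intro i; fin_cases i <;> assumption
    · intro i j hij
      fin_cases i <;> fin_cases j <;> simp at hij <;>
        first
        | (refine ⟨x, ?_⟩; simp [mul_assoc]; done)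
        | exact ⟨x * x, rfl⟩
  rw [Fintype.linearIndependent_iff] at hv ⊢
  intro g hg
  simp only [Fin.sum_univ_four, Matrix.cons_val] at hg
  have h3 : g 3 = 0 := by
    by_contra h
    refine hy (-(g 0 / g 3)) (-(g 1 / g 3)) (-(g 2 / g 3)) ?_
    refine smul_right_injective A h ?_
    simp only [smul_add, smul_smul]
    rw [mul_neg, mul_neg, mul_neg, mul_div_cancel₀ _ h, mul_div_cancel₀ _ h, mul_div_cancel₀ _ h]
    linear_combination (norm := module) hg
  have := hv ![g 0, g 1, g 2] (by
    simpa [Fin.sum_univ_three, h3] using hg)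
  intro i
  fin_cases i
  · exact this 0
  · exact this 1
  · exact this 2
  · exact h3

/-- An element $y$ outside the span of $x,x^2,x^3$ can be corrected by that span to $z$ with $xz=0$.
Then $z^2=cx^3$; the first model is $c=0$, and $c\ne0$ is scaled to 1. -/
theorem prodIso_prodS41_or_prodS32 (hA : IsNilpotentAlgebra A) (hdim : Module.finrank ℝ A = 4)
    {x : A} (hx : x * (x * x) ≠ 0) (hx4 : x * (x * (x * x)) = 0) :
    ProdIso (fun x y : A => x * y) AGL.prodS41 ∨ ProdIso (fun x y : A => x * y) AGL.prodS32 := by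
  have hfin : Module.Finite ℝ A := Module.finite_of_finrank_pos (by omega)
  have h2 : x * x ≠ 0 := fun h => hx (by rw [h, mul_zero])
  have h1 : x ≠ 0 := fun h => h2 (by rw [h, mul_zero])
  obtain ⟨y, hy⟩ : ∃ y, ∀ a b c : ℝ, y ≠ a • x + b • (x * x) + c • (x * (x * x)) := by
    by_contra! h
    have htop : Submodule.span ℝ (Set.range ![x, x * x, x * (x * x)]) = ⊤ := by
      rw [eq_top_iff]
      rintro y -
      obtain ⟨a, b, c, rfl⟩ := h y
      refine add_mem (add_mem ?_ ?_) ?_ <;> refine Submodule.smul_mem _ _ (Submodule.subset_span ?_)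
      exacts [⟨0, rfl⟩, ⟨1, rfl⟩, ⟨2, rfl⟩]
    have := finrank_range_le_card (R := ℝ) ![x, x * x, x * (x * x)]
    rw [Set.finrank, htop, finrank_top, hdim, Fintype.card_fin] at this
    omega
  obtain ⟨t, ht⟩ := exists_coords hdim (linearIndependent_chain_snoc hA hx hy) (x * y)
  simp only [Fin.sum_univ_four, Matrix.cons_val] at ht
  -- Otherwise repeated multiplication of $xy=t_0x+t_1x^2+t_2x^3+t_3y$ by $x$ yields $x^3y=0$, and
  -- solving back puts $x^2y$, $xy$ and finally $y$ in the span of the powers of $x$.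
  have t3 : t 3 = 0 := by
    by_contra h
    have e1 : (x * (x * (x * y))) = 0 := by
      have := congrArg (fun z => x * (x * (x * z))) ht
      simp only [mul_add, mul_smul_comm, hx4, mul_zero, smul_zero, zero_add] at this
      have h4 : x * (x * (x * (x * y))) = 0 := by
        rw [← mul_assoc x x y, ← mul_assoc x (x * x) y, ← mul_assoc x _ y, hx4, zero_mul]
      rw [h4] at this
      exact (smul_eq_zero.1 this.symm).resolve_left h
    have e2 : x * (x * y) = (t 3)⁻¹ • (-(t 0 • (x * (x * x)))) := by
      have := congrArg (fun z => x * (x * z)) ht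
      simp only [mul_add, mul_smul_comm, hx4, smul_zero, add_zero, e1] at this
      rw [eq_inv_smul_iff₀ h]
      linear_combination (norm := module) -this
    have e3 : x * y = (t 3)⁻¹ • (x * (x * y) - t 0 • (x * x) - t 1 • (x * (x * x))) := by
      have := congrArg (fun z => x * z) ht
      simp only [mul_add, mul_smul_comm, hx4, smul_zero, add_zero] at this
      rw [eq_inv_smul_iff₀ h]
      linear_combination (norm := module) -this
    have e4 : y = (t 3)⁻¹ • (x * y - t 0 • x - t 1 • (x * x) - t 2 • (x * (x * x))) := by
      rw [eq_inv_smul_iff₀ h]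
      linear_combination (norm := module) -ht
    refine hy (-((t 3)⁻¹ * t 0)) ((t 3)⁻¹ * (-((t 3)⁻¹ * t 0) - t 1))
      ((t 3)⁻¹ * ((t 3)⁻¹ * (-((t 3)⁻¹ * t 0) - t 1) - t 2)) ?_
    rw [e4, e3, e2]
    module
  -- Now $x(y-t_1x-t_2x^2)=t_0x$, so $t_0$ would be a nonzero eigenvalue.
  have t0 : t 0 = 0 := by
    by_contra h
    refine h1 (hA.eq_zero_of_mul_eq_smul (x := y - t 1 • x - t 2 • (x * x)) h ?_)
    simp only [mul_sub, mul_smul_comm]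
    rw [ht, t3]
    module
  obtain ⟨z, hz, hxz⟩ : ∃ z, (∀ a b c : ℝ, z ≠ a • x + b • (x * x) + c • (x * (x * x))) ∧
      x * z = 0 := by
    refine ⟨y - t 1 • x - t 2 • (x * x), fun a b c h => hy (a + t 1) (b + t 2) c ?_, ?_⟩
    · rw [sub_sub, sub_eq_iff_eq_add] at h
      rw [h]
      module
    · simp only [mul_sub, mul_smul_comm]
      rw [ht, t3, t0]
      module
  clear ht t3 t0 t hy y
  have hv := linearIndependent_chain_snoc hA hx hz
  obtain ⟨t, ht⟩ := exists_coords hdim hv (z * z)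
  simp only [Fin.sum_univ_four, Matrix.cons_val] at ht
  -- Multiply the expansion of $z^2$ by $x$, using $xz=0$ and $x^4=0$.
  have hxt : t 0 • (x * x) + t 1 • (x * (x * x)) = 0 := by
    have := congrArg (fun w => x * w) ht
    simpa [mul_add, mul_smul_comm, hx4, hxz, ← mul_assoc x z z] using this.symm
  have h01 := Fintype.linearIndependent_iff.1 hv ![0, t 0, t 1, 0] (by
    simpa [Fin.sum_univ_four] using hxt)
  have t0 : t 0 = 0 := h01 1
  have t1 : t 1 = 0 := h01 2
  have hxxz : x * x * z = 0 := by rw [mul_assoc, hxz, mul_zero]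
  have hxxxz : x * (x * x) * z = 0 := by rw [mul_assoc, hxxz, mul_zero]
  -- Since $x^3z=0$, multiplying by $z$ gives $z^2z=t_3z^2$. So $t_3\ne0$ forces $z^2=0$, and then
  -- independence gives $t_3=0$.
  have t3 : t 3 = 0 := by
    by_contra h
    have hzz : z * z = 0 := by
      refine hA.eq_zero_of_mul_eq_smul (x := z) h ?_
      conv_lhs => rw [ht, t0, t1]
      simp [add_mul, smul_mul_assoc, hxxxz]
    have := Fintype.linearIndependent_iff.1 hv t (by
      rw [Fin.sum_univ_four]
      simp only [Matrix.cons_val]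
      rw [← ht, hzz]) 3
    exact h this
  rw [t0, t1, t3, zero_smul, zero_smul, zero_smul, zero_add, zero_add, add_zero] at ht
  have hzx : z * x = 0 := by rw [mul_comm, hxz]
  by_cases hc : t 2 = 0
  · left
    rw [hc, zero_smul] at ht
    refine prodIso_of_linearIndependent hdim hv fun p q => ?_
    simp only [Fin.sum_univ_four, AGL.prodS41, Matrix.cons_val, add_mul, mul_add,
      smul_mul_smul_comm, mul_assoc, hx4, hxz, hzx, ht, mul_zero, smul_zero,
      mul_left_comm z x]
    module
  · right
    generalize t 2 = c at ht hc
    -- With these scalings $(cz)^2=c^2\cdot cx^3=(cx)^3$.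
    have hv' : LinearIndependent ℝ ![c • x, c ^ 2 • (x * x), c • z, c ^ 3 • (x * (x * x))] := by
      rw [Fintype.linearIndependent_iff] at hv ⊢
      intro g hg
      have := hv ![g 0 * c, g 1 * c ^ 2, g 3 * c ^ 3, g 2 * c] (by
        simp only [Fin.sum_univ_four, Matrix.cons_val, smul_smul] at hg ⊢
        rw [← hg]
        abel)
      have h' : g 0 = 0 ∧ g 1 = 0 ∧ g 3 = 0 ∧ g 2 = 0 := by
        simpa [Fin.forall_fin_succ, hc] using this
      obtain ⟨g0, g1, g3, g2⟩ := h'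
      intro i
      fin_cases i <;> assumption
    refine prodIso_of_linearIndependent hdim hv' fun p q => ?_
    simp only [Fin.sum_univ_four, AGL.prodS32, Matrix.cons_val, add_mul, mul_add,
      smul_mul_smul_comm, mul_assoc, hx4, hxz, hzx, ht, mul_zero, smul_zero,
      mul_left_comm z x]
    module

end Classification

/-! ### Algebras in which all cubes vanish -/

section CubeZero

/-- The global sign $\varepsilon$ is allowed because it will be absorbed into the generator of the
line of products. -/
theorem signType_normal_form (w : Fin 3 → SignType) : ∃ (σ : Equiv.Perm (Fin 3)) (ε : SignType),
    ε ≠ 0 ∧ ∃ t ∈ [![0, 0, 0], ![1, 0, 0], ![1, 1, 0], ![1, -1, 0], ![1, 1, -1], ![1, 1, 1]],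
      ∀ i, w (σ i) = ε * t i := by
  revert w
  decide

theorem linearIndependent_of_disjoint {V : Type*} [AddCommGroup V]
    [Module ℝ V] {S W : Submodule ℝ V} (hd : Disjoint S W) {u v p q : V}
    (hu : u ∈ W) (hv : v ∈ W) (hp : p ∈ S) (hq : q ∈ S) (huv : LinearIndependent ℝ ![u, v])
    (hpq : LinearIndependent ℝ ![p, q]) : LinearIndependent ℝ ![u, v, p, q] := by
  rw [LinearIndependent.pair_iff] at huv hpq
  rw [Fintype.linearIndependent_iff]
  intro g hg
  simp only [Fin.sum_univ_four, Matrix.cons_val] at hg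
  have hS : g 2 • p + g 3 • q ∈ S := add_mem (S.smul_mem _ hp) (S.smul_mem _ hq)
  have hW : g 0 • u + g 1 • v ∈ W := add_mem (W.smul_mem _ hu) (W.smul_mem _ hv)
  have e : g 0 • u + g 1 • v = -(g 2 • p + g 3 • q) := by
    rw [eq_neg_iff_add_eq_zero, ← hg, add_assoc, add_assoc, add_assoc]
  have h0 : g 0 • u + g 1 • v = 0 :=
    Submodule.disjoint_def.1 hd _ (e ▸ neg_mem hS) hW
  obtain ⟨g0, g1⟩ := huv _ _ h0
  obtain ⟨g2, g3⟩ := hpq _ _ (neg_eq_zero.1 (e.symm.trans h0))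
  intro i
  fin_cases i <;> assumption

variable {A : Type*} [NonUnitalCommRing A] [Module ℝ A]

/-- The span of all products. -/
def sqSpan (A : Type*) [NonUnitalCommRing A] [Module ℝ A] : Submodule ℝ A :=
  Submodule.span ℝ {z | ∃ x y, x * y = z}

theorem mul_mem_sqSpan (x y : A) : x * y ∈ sqSpan A := Submodule.subset_span ⟨x, y, rfl⟩

theorem prodIso_zero (hdim : Module.finrank ℝ A = 4) (h : ∀ x y : A, x * y = 0) :
    ProdIso (fun x y : A => x * y) (AGL.prodRD 0 0 0) := by
  have hfin : Module.Finite ℝ A := Module.finite_of_finrank_pos (by omega)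
  refine ⟨LinearEquiv.ofFinrankEq A (Fin 4 → ℝ) (by simp [hdim]), fun x y => ?_⟩
  simp only [h, map_zero]
  exact (AGL.isZeroProd_prodRD _ _).symm

section

variable [SMulCommClass ℝ A A]

theorem mul_eq_zero_of_mem_sqSpan (h : ∀ x y z : A, x * (y * z) = 0) {s : A} (hs : s ∈ sqSpan A)
    (x : A) : x * s = 0 := by
  have : sqSpan A ≤ LinearMap.ker (LinearMap.mulLeft ℝ x) := by
    refine Submodule.span_le.2 ?_
    rintro _ ⟨y, z, rfl⟩
    exact h x y z
  exact this hs

/-- As $A^2$ annihilates $A$, a product depends only on the $W$-components of its factors. -/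
theorem sqSpan_le_of_isCompl (h : ∀ x y z : A, x * (y * z) = 0) {W T : Submodule ℝ A}
    (hW : IsCompl (sqSpan A) W) (hT : ∀ x ∈ W, ∀ y ∈ W, x * y ∈ T) : sqSpan A ≤ T := by
  refine Submodule.span_le.2 ?_
  rintro _ ⟨x, y, rfl⟩
  obtain ⟨s, hs, x, hx, rfl⟩ := Submodule.mem_sup.1 (hW.sup_eq_top ▸ Submodule.mem_top (x := x))
  obtain ⟨t, ht, y, hy, rfl⟩ := Submodule.mem_sup.1 (hW.sup_eq_top ▸ Submodule.mem_top (x := y))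
  have : (s + x) * (t + y) = x * y := by
    rw [mul_add, mul_eq_zero_of_mem_sqSpan h ht, zero_add, mul_comm, mul_add,
      mul_eq_zero_of_mem_sqSpan h hs, zero_add, mul_comm]
  rw [SetLike.mem_coe, this]
  exact hT x hx y hy

end

variable [IsScalarTower ℝ A A] [SMulCommClass ℝ A A]

theorem mul_mul_eq_zero_of_cube_eq_zero (h : ∀ x : A, x * (x * x) = 0) (x y z : A) :
    x * (y * z) = 0 := by
  have h' : ∀ x : A, (x : Unitization ℝ A) * (x * x) = 0 := fun x => by
    rw [← Unitization.inr_mul, ← Unitization.inr_mul, h, Unitization.inr_zero]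
  -- Polarization of the cube, carried out in the unitization to have a commutative ring with 1.
  have key : (6 : Unitization ℝ A) * (x * (y * z)) = 0 := by
    have e1 := h' (x + y + z)
    have e2 := h' (x + y)
    have e3 := h' (y + z)
    have e4 := h' (x + z)
    simp only [Unitization.inr_add] at e1 e2 e3 e4
    linear_combination e1 - e2 - e3 - e4 + h' x + h' y + h' z
  have key' : (6 : ℝ) • (x * (y * z)) = 0 := by
    apply Unitization.inr_injective (R := ℝ)
    rw [Unitization.inr_smul, Unitization.inr_mul, Unitization.inr_mul, Unitization.inr_zero, ← key,
      Algebra.smul_def, map_ofNat]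
  exact (smul_eq_zero.1 key').resolve_left (by norm_num)

/-- If $u$ spans $W$, all products are multiples of $u^2$. -/
theorem finrank_sqSpan_le_one (h : ∀ x y z : A, x * (y * z) = 0) {W : Submodule ℝ A}
    (hW : IsCompl (sqSpan A) W) [Module.Finite ℝ A] (h1 : Module.finrank ℝ W ≤ 1) :
    Module.finrank ℝ (sqSpan A) ≤ 1 := by
  obtain ⟨u, hu⟩ := finrank_le_one_iff.1 h1
  have : sqSpan A ≤ ℝ ∙ ((u : A) * u) := by
    refine sqSpan_le_of_isCompl h hW fun x hx y hy => ?_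
    obtain ⟨c, hc⟩ := hu ⟨x, hx⟩
    obtain ⟨d, hd⟩ := hu ⟨y, hy⟩
    have hc : c • (u : A) = x := congrArg Subtype.val hc
    have hd : d • (u : A) = y := congrArg Subtype.val hd
    rw [← hc, ← hd, smul_mul_smul_comm]
    exact Submodule.smul_mem _ _ (Submodule.mem_span_singleton_self _)
  exact (Submodule.finrank_mono this).trans ((finrank_span_le_card {(u : A) * u}).trans (by simp))

/-- With $A^2=\mathbb Rz$, the product on $W$ is $z$ times a symmetric bilinear form. Sylvester's
law diagonalizes it with entries $0,\pm1$; a permutation of the basis and the replacement of $z$ by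
$\varepsilon z$ bring the signs to normal form. -/
theorem exists_prodIso_prodRD [Module.Finite ℝ A] (hdim : Module.finrank ℝ A = 4)
    (h : ∀ x y z : A, x * (y * z) = 0) {W : Submodule ℝ A} (hW : IsCompl (sqSpan A) W)
    (h3 : Module.finrank ℝ W = 3) (h1 : Module.finrank ℝ (sqSpan A) = 1) :
    ∃ t ∈ [![0, 0, 0], ![1, 0, 0], ![1, 1, 0], ![1, -1, 0], ![1, 1, -1], ![1, 1, 1]],
      ProdIso (fun x y : A => x * y)
        (AGL.prodRD ((t 0 : SignType) : ℝ) ((t 1 : SignType) : ℝ) ((t 2 : SignType) : ℝ)) := by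
  obtain ⟨⟨z, hz⟩, hz0, hzs⟩ := finrank_eq_one_iff'.1 h1
  have hz0 : z ≠ 0 := fun h => hz0 (Subtype.ext h)
  have hzs : ∀ s ∈ sqSpan A, ∃ c : ℝ, c • z = s := fun s hs => by
    obtain ⟨c, hc⟩ := hzs ⟨s, hs⟩
    exact ⟨c, congrArg Subtype.val hc⟩
  obtain ⟨ψ, hψ⟩ := Module.Projective.exists_dual_eq_one ℝ hz0
  have hmul : ∀ x y : A, x * y = ψ (x * y) • z := fun x y => by
    obtain ⟨c, hc⟩ := hzs _ (mul_mem_sqSpan x y)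
    rw [← hc, map_smul, hψ, smul_eq_mul, mul_one]
  let Q : QuadraticForm ℝ W := LinearMap.BilinMap.toQuadraticMap
    (((LinearMap.mul ℝ A).compr₂ ψ).domRestrict₁₂ W W)
  have hQ : ∀ x : W, Q x = ψ ((x : A) * x) := fun x => rfl
  obtain ⟨w, ⟨e⟩⟩ := Q.equivalent_signType_weighted_sum_squared
  -- The weights are indexed by `Fin` of the rank; this makes the index type literally `Fin 3`.
  generalize Module.finrank ℝ W = n at h3 w e
  subst h3
  have heQ : ∀ a : Fin 3 → ℝ, ψ ((e.symm a : A) * e.symm a) = ∑ i, (w i : ℝ) * (a i * a i) := by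
    intro a
    rw [← hQ, ← e.map_app, e.apply_symm_apply]
    simp [QuadraticMap.weightedSumSquares_apply]
  have heB : ∀ a b : Fin 3 → ℝ, (e.symm a : A) * e.symm b =
      (∑ i, (w i : ℝ) * (a i * b i)) • z := by
    intro a b
    rw [hmul]
    congr 1
    have h1 := heQ (a + b)
    have h2 := heQ a
    have h3 := heQ b
    simp only [map_add, Submodule.coe_add, mul_add, add_mul, Pi.add_apply, Fin.sum_univ_three,
      mul_comm (e.symm b : A) (e.symm a : A)] at h1 h2 h3 ⊢
    linarith
  have hzann : ∀ x : A, x * z = 0 := fun x => mul_eq_zero_of_mem_sqSpan h hz x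
  have hzann' : ∀ x : A, z * x = 0 := fun x => by rw [mul_comm, hzann]
  obtain ⟨σ, ε, hε, t, ht, hw⟩ := signType_normal_form w
  have hε' : (ε : ℝ) ≠ 0 := by
    cases ε <;> simp at hε ⊢
  refine ⟨t, ht, ?_⟩
  let f : Fin 3 → A := fun i => e.symm (Pi.single (σ i) 1)
  have hf : ∀ i j, f i * f j = if i = j then ((ε : ℝ) * (t i : ℝ)) • z else 0 := by
    intro i j
    rw [heB]
    split_ifs with hij
    · subst hij
      rw [Finset.sum_eq_single (σ i)]
      · simp [hw]
      · intro k _ hk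
        simp [hk]
      · simp
    · rw [Finset.sum_eq_zero, zero_smul]
      intro k _
      by_cases hk : k = σ i
      · subst hk
        simp [hij]
      · simp [hk]
  have hli : LinearIndependent ℝ ![f 0, f 1, f 2, (ε : ℝ) • z] := by
    rw [Fintype.linearIndependent_iff]
    intro g hg
    simp only [Fin.sum_univ_four, Matrix.cons_val] at hg
    have hfW : g 0 • f 0 + g 1 • f 1 + g 2 • f 2 =
        (e.symm (fun i => ![g 0, g 1, g 2] (σ.symm i)) : W) := by
      have hsum : (fun i => ![g 0, g 1, g 2] (σ.symm i)) = g 0 • Pi.single (σ 0) (1 : ℝ) +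
          g 1 • Pi.single (σ 1) (1 : ℝ) + g 2 • Pi.single (σ 2) (1 : ℝ) := by
        ext k
        obtain ⟨j, rfl⟩ := σ.surjective k
        fin_cases j <;> simp
      rw [hsum, map_add, map_add, map_smul, map_smul, map_smul]
      rfl
    have hmem : (g 3 * ε) • z ∈ sqSpan A := Submodule.smul_mem _ _ hz
    rw [hfW, smul_smul, ← eq_neg_iff_add_eq_zero] at hg
    have h0 := Submodule.disjoint_def.1 hW.disjoint _ (hg ▸ neg_mem hmem) (Subtype.mem _)
    rw [h0, eq_comm, neg_eq_zero, smul_eq_zero, or_iff_left hz0, mul_eq_zero, or_iff_left hε'] at hg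
    have h1 := congrFun ((map_eq_zero_iff _ e.symm.injective).1 (Subtype.ext h0 : e.symm _ = 0))
    have h2 := fun i => h1 (σ i)
    simp only [Equiv.symm_apply_apply, Pi.zero_apply] at h2
    intro i
    fin_cases i
    · exact h2 0
    · exact h2 1
    · exact h2 2
    · exact hg
  refine prodIso_of_linearIndependent hdim hli fun p q => ?_
  simp only [Fin.sum_univ_four, AGL.prodRD, Matrix.cons_val, add_mul, mul_add,
    hf, smul_mul_assoc, mul_smul_comm, hzann, hzann', smul_zero]
  simp
  module

theorem exists_prodIso_prodU1 (hdim : Module.finrank ℝ A = 4)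
    (h : ∀ x y z : A, x * (y * z) = 0) {u v : A} (hv : LinearIndependent ℝ ![u, v, u * u, u * v]) :
    ∃ β ∈ [(0 : ℝ), 1, -1], ProdIso (fun x y : A => x * y) (AGL.prodU1 β) := by
  obtain ⟨c, hc⟩ := exists_coords hdim hv (v * v)
  simp only [Fin.sum_univ_four, Matrix.cons_val] at hc
  have hv' := Fintype.linearIndependent_iff.1 hv
  have h01 : c 0 • (u * u) + c 1 • (u * v) = 0 := by
    have := congrArg (fun z => u * z) hc
    simpa [mul_add, mul_smul_comm, h] using this.symm
  have h01 := hv' ![0, 0, c 0, c 1] (by simpa [Fin.sum_univ_four] using h01)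
  have c0 : c 0 = 0 := h01 2
  have c1 : c 1 = 0 := h01 3
  rw [c0, c1, zero_smul, zero_smul, zero_add, zero_add] at hc
  -- Completing the square, $v'=v-\frac{c_3}{2}u$ satisfies $v'^2=(c_2+c_3^2/4)u^2$; the factor $t$
  -- normalizes this coefficient to $0$ or $\pm1$.
  obtain ⟨t, β, ht, hβ, htβ⟩ : ∃ t β : ℝ, t ≠ 0 ∧ β ∈ [(0 : ℝ), 1, -1] ∧
      t ^ 2 * (c 2 + c 3 ^ 2 / 4) = β := by
    generalize c 2 + c 3 ^ 2 / 4 = a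
    rcases lt_trichotomy a 0 with ha | rfl | ha
    · refine ⟨(√(-a))⁻¹, -1, inv_ne_zero (Real.sqrt_ne_zero'.2 (by linarith)), by simp, ?_⟩
      rw [inv_pow, Real.sq_sqrt (by linarith), inv_neg, neg_mul, inv_mul_cancel₀ ha.ne]
    · exact ⟨1, 0, one_ne_zero, by simp, by simp⟩
    · refine ⟨(√a)⁻¹, 1, inv_ne_zero (Real.sqrt_ne_zero'.2 ha), by simp, ?_⟩
      rw [inv_pow, Real.sq_sqrt ha.le]
      field_simp
  have hw : LinearIndependent ℝ ![u, t • (v - (c 3 / 2) • u), u * u,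
      t • (u * v - (c 3 / 2) • (u * u))] := by
    rw [Fintype.linearIndependent_iff]
    intro g hg
    simp only [Fin.sum_univ_four, Matrix.cons_val] at hg
    have := hv' ![g 0 - g 1 * t * (c 3 / 2), g 1 * t, g 2 - g 3 * t * (c 3 / 2), g 3 * t] (by
      rw [← hg]
      simp only [Fin.sum_univ_four, Matrix.cons_val]
      module)
    have g1 : g 1 = 0 := by simpa [ht] using this 1
    have g3 : g 3 = 0 := by simpa [ht] using this 3
    have g0 : g 0 = 0 := by simpa [g1] using this 0
    have g2 : g 2 = 0 := by simpa [g3] using this 2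
    intro i
    fin_cases i <;> assumption
  refine ⟨β, hβ, prodIso_of_linearIndependent hdim hw fun p q => ?_⟩
  subst htβ
  simp only [Fin.sum_univ_four, AGL.prodU1, Matrix.cons_val, add_mul, mul_add, mul_sub, sub_mul,
    smul_mul_assoc, mul_smul_comm, mul_assoc, h, smul_zero, mul_comm v u, hc]
  module

/-- The products $u^2,uv,v^2$ of a basis of $W$ do not lie on one line. If $uv\ne0$, one of
$u^2,v^2$ is off $\mathbb R\,uv$, and $(u,v)$ or $(v,u)$ works. If $uv=0$, then $u^2,v^2$ are
independent and $(u+v,u)$ works, with products $u^2+v^2$ and $u^2$. -/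
theorem exists_linearIndependent_of_finrank_two (h : ∀ x y z : A, x * (y * z) = 0)
    [Module.Finite ℝ A] {W : Submodule ℝ A} (hW : IsCompl (sqSpan A) W)
    (h2 : Module.finrank ℝ W = 2) (hS : 2 ≤ Module.finrank ℝ (sqSpan A)) :
    ∃ u v : A, LinearIndependent ℝ ![u, v, u * u, u * v] := by
  let b := Module.finBasisOfFinrankEq ℝ W h2
  obtain ⟨u, hu, v, hv, huv, hb⟩ : ∃ u ∈ W, ∃ v ∈ W, LinearIndependent ℝ ![u, v] ∧
      ∀ x ∈ W, ∃ c d : ℝ, x = c • u + d • v := by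
    refine ⟨b 0, (b 0).2, b 1, (b 1).2, ?_, fun x hx => ⟨b.repr ⟨x, hx⟩ 0, b.repr ⟨x, hx⟩ 1, ?_⟩⟩
    · have := b.linearIndependent.map' W.subtype W.ker_subtype
      have hb : ![(b 0 : A), (b 1 : A)] = W.subtype ∘ b := by ext i; fin_cases i <;> rfl
      rwa [hb]
    · have := congrArg Subtype.val (b.sum_repr ⟨x, hx⟩)
      rw [Fin.sum_univ_two] at this
      exact this.symm
  have hspan : ∀ z : A, ¬ (u * u ∈ ℝ ∙ z ∧ u * v ∈ ℝ ∙ z ∧ v * v ∈ ℝ ∙ z) := by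
    rintro z ⟨h1, h2, h3⟩
    have : sqSpan A ≤ ℝ ∙ z := by
      refine sqSpan_le_of_isCompl h hW fun x hx y hy => ?_
      obtain ⟨c, d, rfl⟩ := hb x hx
      obtain ⟨c', d', rfl⟩ := hb y hy
      simp only [add_mul, mul_add, smul_mul_assoc, mul_smul_comm, mul_comm v u]
      have hsmul : ∀ (c : ℝ) {x : A}, x ∈ ℝ ∙ z → c • x ∈ ℝ ∙ z := fun c _ =>
        Submodule.smul_mem _ c
      exact add_mem (hsmul _ (add_mem (hsmul _ h1) (hsmul _ h2)))
        (hsmul _ (add_mem (hsmul _ h2) (hsmul _ h3)))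
    have := (Submodule.finrank_mono this).trans ((finrank_span_le_card {z}).trans (by simp) : _ ≤ 1)
    omega
  have hsub := @mul_mem_sqSpan A _ _
  have hpair : ∀ {x y : A}, x ≠ 0 → y ∉ ℝ ∙ x → LinearIndependent ℝ ![x, y] := fun hx hy =>
    (LinearIndependent.pair_iff' hx).2 fun a ha => hy (Submodule.mem_span_singleton.2 ⟨a, ha⟩)
  have hself := @Submodule.mem_span_singleton_self ℝ A _ _ _
  have hvu := LinearIndependent.pair_symm_iff.1 huv
  by_cases hq : u * v = 0
  · have hp0 : u * u ≠ 0 := fun hp => hspan (v * v) (by simp [hp, hq, hself])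
    have hr : v * v ∉ ℝ ∙ (u * u) := fun hr => hspan (u * u) (by simp [hr, hq, hself])
    refine ⟨u + v, u, linearIndependent_of_disjoint hW.disjoint (add_mem hu hv) hu (hsub _ _)
      (hsub _ _) ?_ ?_⟩
    · rw [LinearIndependent.pair_iff] at huv ⊢
      intro s t hst
      obtain ⟨h1, h2⟩ := huv (s + t) s (by rw [← hst]; module)
      exact ⟨h2, by linarith⟩
    · have := hpair hp0 hr
      rw [LinearIndependent.pair_iff] at this ⊢
      intro s t hst
      simp only [add_mul, mul_add, mul_comm v u, hq, zero_add, add_zero] at hst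
      obtain ⟨h1, h2⟩ := this (s + t) s (by rw [← hst]; module)
      exact ⟨h2, by linarith⟩
  · by_cases hp : u * u ∈ ℝ ∙ (u * v)
    · have hr : v * v ∉ ℝ ∙ (u * v) := fun hr => hspan (u * v) ⟨hp, hself _, hr⟩
      exact ⟨v, u, linearIndependent_of_disjoint hW.disjoint hv hu (hsub _ _) (hsub _ _) hvu
        (LinearIndependent.pair_symm_iff.1 (by rw [mul_comm v u]; exact hpair hq hr))⟩
    · exact ⟨u, v, linearIndependent_of_disjoint hW.disjoint hu hv (hsub _ _) (hsub _ _) huv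
        (LinearIndependent.pair_symm_iff.1 (hpair hq hp))⟩

theorem exists_prodIso_realProd (hA : IsNilpotentAlgebra A) (hdim : Module.finrank ℝ A = 4) :
    ∃ i, ProdIso (fun x y : A => x * y) (AGL.realProd i) := by
  have hfin : Module.Finite ℝ A := Module.finite_of_finrank_pos (by omega)
  by_cases h4 : ∀ x : A, x * (x * (x * x)) = 0
  swap
  · push Not at h4
    obtain ⟨x, hx⟩ := h4
    exact ⟨0, prodIso_prodS5 hA hdim hx⟩
  by_cases h3 : ∀ x : A, x * (x * x) = 0
  swap
  · push Not at h3
    obtain ⟨x, hx⟩ := h3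
    rcases prodIso_prodS41_or_prodS32 hA hdim hx (h4 x) with h | h
    · exact ⟨1, h⟩
    · exact ⟨2, h⟩
  have h := mul_mul_eq_zero_of_cube_eq_zero h3
  obtain ⟨W, hW⟩ := Submodule.exists_isCompl (sqSpan A)
  have hsum := Submodule.finrank_add_eq_of_isCompl hW
  rw [hdim] at hsum
  -- This excludes $\dim W\le1$, so $\dim A^2\ge2$ forces $\dim W=2$.
  have hle := finrank_sqSpan_le_one h hW
  rcases Nat.lt_or_ge (Module.finrank ℝ (sqSpan A)) 2 with hs | hs
  · rcases Nat.lt_or_ge (Module.finrank ℝ (sqSpan A)) 1 with hs' | hs'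
    · have : sqSpan A = ⊥ := Submodule.finrank_eq_zero.1 (by omega)
      exact ⟨11, prodIso_zero hdim fun x y => (Submodule.mem_bot ℝ).1 (this ▸ mul_mem_sqSpan x y)⟩
    · obtain ⟨t, ht, hiso⟩ := exists_prodIso_prodRD hdim h hW (by omega) (by omega)
      simp only [List.mem_cons, List.not_mem_nil, or_false] at ht
      rcases ht with rfl | rfl | rfl | rfl | rfl | rfl
      -- The zero form cannot occur when $\dim A^2=1$, but it matches a model anyway and need not be
      -- excluded.
      · exact ⟨11, (by simpa using hiso : ProdIso _ (AGL.prodRD 0 0 0))⟩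
      · exact ⟨6, (by simpa using hiso : ProdIso _ (AGL.prodRD 1 0 0))⟩
      · exact ⟨7, (by simpa using hiso : ProdIso _ (AGL.prodRD 1 1 0))⟩
      · exact ⟨8, (by simpa using hiso : ProdIso _ (AGL.prodRD 1 (-1) 0))⟩
      · exact ⟨9, (by simpa using hiso : ProdIso _ (AGL.prodRD 1 1 (-1)))⟩
      · exact ⟨10, (by simpa using hiso : ProdIso _ (AGL.prodRD 1 1 1))⟩
  · obtain ⟨u, v, huv⟩ := exists_linearIndependent_of_finrank_two h hW (by omega) hs
    obtain ⟨β, hβ, hiso⟩ := exists_prodIso_prodU1 hdim h huv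
    simp only [List.mem_cons, List.not_mem_nil, or_false] at hβ
    rcases hβ with rfl | rfl | rfl
    · exact ⟨3, hiso⟩
    · exact ⟨4, hiso⟩
    · exact ⟨5, hiso⟩

end CubeZero

/-! ### From algebras back to subgroups, and counting -/

theorem IsNilpotentAlgebra.of_equiv {A B : Type*} [NonUnitalRing A] [NonUnitalRing B]
    (hA : IsNilpotentAlgebra A) (e : A ≃+* B) : IsNilpotentAlgebra B := by
  obtain ⟨k, hk⟩ := hA
  have key : ∀ (l : List B) (b : B),
      e.symm (l.foldl (· * ·) b) = (l.map e.symm).foldl (· * ·) (e.symm b) := by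
    intro l
    induction l with
    | nil => intro b; rfl
    | cons c l ih => intro b; rw [List.foldl_cons, ih, map_mul]; rfl
  refine ⟨k, fun b l hl => e.symm.injective ?_⟩
  rw [key, hk _ _ (by rw [List.length_map, hl]), map_zero]

namespace AGL

section

variable {n : ℕ} {F : Type*} [Field F] {R : Subgroup (AGL n F)}

/-- `R - I` as a commutative algebra. -/
abbrev nilCommRing (hR : IsRegular R) (hA : IsAbelian R) : NonUnitalCommRing (nilAlgebra R) :=
  { (inferInstance : NonUnitalRing (nilAlgebra R)) with mul_comm := nilAlgebra_mul_comm hR hA }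

/-- A copy of `R - I` in an arbitrary universe, as a commutative nilpotent algebra. -/
def toCommNilpotentAlgebra {F : Type} [Field F] {R : Subgroup (AGL n F)} (hR : IsRegular R)
    (hA : IsAbelian R) : CommNilpotentAlgebra.{u} F n :=
  letI := nilCommRing hR hA
  { carrier := ULift.{u} (nilAlgebra R)
    isScalarTower := ⟨fun c x y => ULift.ext _ _ (smul_mul_assoc c x.down y.down)⟩
    smulCommClass := ⟨fun c x y => ULift.ext _ _ (mul_smul_comm c x.down y.down).symm⟩
    finite := Module.Finite.equiv ((rowEquiv hR hA).symm.trans ULift.moduleEquiv.symm)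
    finrank_eq := ULift.moduleEquiv.finrank_eq.trans (finrank_nilAlgebra hR hA)
    nilpotent := (isNilpotentAlgebra_nilAlgebra hR hA).of_equiv ULift.ringEquiv.symm }

theorem toCommNilpotentAlgebra_algIsomorphic {F : Type} [Field F] {R : Subgroup (AGL n F)}
    (hR : IsRegular R) (hA : IsAbelian R) :
    AlgIsomorphic F (toCommNilpotentAlgebra.{u} hR hA).carrier (nilAlgebra R) :=
  ⟨ULift.moduleEquiv, fun _ _ => rfl⟩

end

/-- `AlgIsomorphic ℝ` unfolds to `ProdIso` of the multiplications. Existence is the classification;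
uniqueness holds because `prodIndex` of the multiplication of $A$ recovers the index. -/
theorem existsUnique_algIsomorphic {A : Type*} [NonUnitalCommRing A] [Module ℝ A]
    [IsScalarTower ℝ A A] [SMulCommClass ℝ A A] (hA : IsNilpotentAlgebra A)
    (hdim : Module.finrank ℝ A = 4) : ∃! i, AlgIsomorphic ℝ A (nilAlgebra (realRep i)) := by
  obtain ⟨i, hi⟩ := exists_prodIso_realProd hA hdim
  refine ⟨i, hi.trans (realizes_realRep i).2.2.symm, fun j hj => ?_⟩
  have hj' : ProdIso (fun x y : A => x * y) (realProd j) :=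
    ProdIso.trans hj (realizes_realRep j).2.2
  rw [← prodIndex_realProd i, ← prodIndex_realProd j, ← hi.prodIndex_eq, ← hj'.prodIndex_eq]

theorem areConj_iff_algIsomorphic {n : ℕ} {F : Type*} [Field F] {R S : Subgroup (AGL n F)}
    (hR : IsRegular R) (hA : IsAbelian R) (hS : IsRegular S) (hB : IsAbelian S) :
    AreConj R S ↔ AlgIsomorphic F (nilAlgebra R) (nilAlgebra S) :=
  ⟨algIsomorphic_of_areConj hR hA hS hB, areConj_of_algIsomorphic hR hA hS hB⟩

theorem existsUnique_areConj {R : Subgroup (AGL 4 ℝ)} (hR : IsRegular R) (hA : IsAbelian R) :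
    ∃! i, AreConj R (realRep i) := by
  have h := @existsUnique_algIsomorphic (nilAlgebra R) (nilCommRing hR hA) _ _ _
    (isNilpotentAlgebra_nilAlgebra hR hA) (finrank_nilAlgebra hR hA)
  simpa only [fun i => areConj_iff_algIsomorphic hR hA (realizes_realRep i).1
    (realizes_realRep i).2.1] using h

theorem card_quotient_of_existsUnique {X : Type*} (s : Setoid X) {n : ℕ} (f : Fin n → X)
    (h : ∀ x, ∃! i, s x (f i)) : Nat.card (Quotient s) = n := by
  refine (Nat.card_eq_of_bijective (fun i => Quotient.mk s (f i)) ⟨fun i j hij => ?_, ?_⟩).symm.trans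
    (Nat.card_fin n)
  · exact (h (f i)).unique (s.refl _) (Quotient.exact hij)
  · intro q
    induction q using Quotient.ind with
    | _ x =>
      obtain ⟨i, hi, -⟩ := h x
      exact ⟨i, Quotient.sound (s.symm hi)⟩

end AGL

theorem mainTheorem7 :
    -- there are exactly `12` conjugacy classes of abelian regular subgroups of `AGL_4(ℝ)`
    Nat.card (AGL.AbelianRegularClasses 4 ℝ) = 12 ∧
    -- the listed subgroups form a complete and irredundant set of representatives
    (∀ i, AGL.IsRegular (AGL.realRep i) ∧ AGL.IsAbelian (AGL.realRep i)) ∧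
    (∀ R : Subgroup (AGL 4 ℝ), AGL.IsRegular R → AGL.IsAbelian R →
      ∃! i, AGL.AreConj R (AGL.realRep i)) ∧
    -- `R ↦ R - I` maps abelian regular subgroups to commutative nilpotent algebras of dimension `4`
    (∀ R : Subgroup (AGL 4 ℝ), AGL.IsRegular R → AGL.IsAbelian R →
      (AGL.nilAlgebra R : Set (Matrix (Fin 5) (Fin 5) ℝ)) = AGL.subOne R ∧
      (∀ x y : AGL.nilAlgebra R, x * y = y * x) ∧
      Module.finrank ℝ (AGL.nilAlgebra R) = 4 ∧
      IsNilpotentAlgebra (AGL.nilAlgebra R)) ∧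
    -- conjugate subgroups correspond to isomorphic algebras
    (∀ R S : Subgroup (AGL 4 ℝ), AGL.IsRegular R → AGL.IsAbelian R →
      AGL.IsRegular S → AGL.IsAbelian S →
      (AGL.AreConj R S ↔ AlgIsomorphic ℝ (AGL.nilAlgebra R) (AGL.nilAlgebra S))) ∧
    -- there are exactly `12` commutative nilpotent real algebras of dimension `4`, up to isomorphism
    Nat.card (CommNilpotentAlgebra.IsoClasses.{u} ℝ 4) = 12 ∧
    -- they are represented by the algebras `R - I`, `R` in the list
    (∀ A : CommNilpotentAlgebra.{u} ℝ 4,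
      ∃! i, AlgIsomorphic ℝ A.carrier (AGL.nilAlgebra (AGL.realRep i))) := by
  have hrep := AGL.realizes_realRep
  have hconj : ∀ R : Subgroup (AGL 4 ℝ), AGL.IsRegular R → AGL.IsAbelian R →
      ∃! i, AGL.AreConj R (AGL.realRep i) := fun R hR hA => AGL.existsUnique_areConj hR hA
  have halg : ∀ A : CommNilpotentAlgebra.{u} ℝ 4,
      ∃! i, AlgIsomorphic ℝ A.carrier (AGL.nilAlgebra (AGL.realRep i)) := fun A =>
    AGL.existsUnique_algIsomorphic A.nilpotent A.finrank_eq
  refine ⟨?_, fun i => ⟨(hrep i).1, (hrep i).2.1⟩, hconj, fun R hR hA => ⟨AGL.coe_nilAlgebra hR hA,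
    AGL.nilAlgebra_mul_comm hR hA, AGL.finrank_nilAlgebra hR hA,
    AGL.isNilpotentAlgebra_nilAlgebra hR hA⟩, fun R S hR hA hS hB =>
    AGL.areConj_iff_algIsomorphic hR hA hS hB, ?_, halg⟩
  · exact AGL.card_quotient_of_existsUnique _
      (fun i => ⟨AGL.realRep i, (hrep i).1, (hrep i).2.1⟩) fun R => hconj R.1 R.2.1 R.2.2
  · refine AGL.card_quotient_of_existsUnique _
      (fun i => AGL.toCommNilpotentAlgebra.{u} (hrep i).1 (hrep i).2.1) fun A => ?_
    have hiff : ∀ i, CommNilpotentAlgebra.isoSetoid ℝ 4 A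
        (AGL.toCommNilpotentAlgebra.{u} (hrep i).1 (hrep i).2.1) ↔
        AlgIsomorphic ℝ A.carrier (AGL.nilAlgebra (AGL.realRep i)) := fun i =>
      have h := AGL.toCommNilpotentAlgebra_algIsomorphic.{u} (hrep i).1 (hrep i).2.1
      ⟨fun h' => ProdIso.trans h' h, fun h' => ProdIso.trans h' (ProdIso.symm h)⟩
    simpa only [hiff] using halg A
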